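/- Let $\mathbb{K}$ be a commutative ring, let $A, B, C$ be associative unital $\mathbb{K}$-algebras (not necessarily commutative) that are flat as $\mathbb{K}$-modules, and let $\mathbb{K}'$ be a commutative $\mathbb{K}$-algebra. Put $A' := \mathbb{K}' \otimes_{\mathbb{K}} A$, $B' := \mathbb{K}' \otimes_{\mathbb{K}} B$ and $C' := \mathbb{K}' \otimes_{\mathbb{K}} C$. Write $\mathsf{D}^-(\mathsf{Mod}\, R)$ for the bounded above derived category of (left) $R$-modules. Base change of bimodules has a left derived functor $$\mathbb{K}' \otimes^{\mathrm{L}}_{\mathbb{K}} - \;:\; \mathsf{D}^-(\mathsf{Mod}\, A \otimes_{\mathbb{K}} B^{\mathrm{op}}) \to \mathsf{D}^-(\mathsf{Mod}\, A' \otimes_{\mathbb{K}'} B'^{\,\mathrm{op}}),$$ and likewise for the pairs $(B, C)$ and $(A, C)$; the tensor product of bimodules has a left derived bifunctor $$- \otimes^{\mathrm{L}}_{B} - \;:\; \mathsf{D}^-(\mathsf{Mod}\, A \otimes_{\mathbb{K}} B^{\mathrm{op}}) \times \mathsf{D}^-(\mathsf{Mod}\, B \otimes_{\mathbb{K}} C^{\mathrm{op}})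 \to \mathsf{D}^-(\mathsf{Mod}\, A \otimes_{\mathbb{K}} C^{\mathrm{op}}),$$ and likewise $- \otimes^{\mathrm{L}}_{B'} -$ for $A', B', C'$ over $\mathbb{K}'$. For $M \in \mathsf{D}^-(\mathsf{Mod}\, A \otimes_{\mathbb{K}} B^{\mathrm{op}})$ and $N \in \mathsf{D}^-(\mathsf{Mod}\, B \otimes_{\mathbb{K}} C^{\mathrm{op}})$ put $M' := \mathbb{K}' \otimes^{\mathrm{L}}_{\mathbb{K}} M$ and $N' := \mathbb{K}' \otimes^{\mathrm{L}}_{\mathbb{K}} N$. Then there is an isomorphism $$M' \otimes^{\mathrm{L}}_{B'} N' \;\cong\; \mathbb{K}' \otimes^{\mathrm{L}}_{\mathbb{K}} (M \otimes^{\mathrm{L}}_{B} N)$$ in $\mathsf{D}^-(\mathsf{Mod}\, A' \otimes_{\mathbb{K}'} C'^{\,\mathrm{op}})$, functorial in $M$ and $N$. -/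

import Mathlib

universe u v

open CategoryTheory TensorProduct

noncomputable section

namespace DerivedBimod

section Kan

variable {H D E : Type*} [Category* H] [Category* D] [Category* E] {L : H ⥤ D} {p : D ⥤ H}
  (adj : p ⊣ L) (F : H ⥤ E)

/-- For `p` left adjoint to `L`, the morphism `L ⋙ p ⋙ F ⟶ F` given by the counit. -/
def adjCounit : L ⋙ p ⋙ F ⟶ F where
  app X := F.map (adj.counit.app X)
  naturality X Y f := by
    have h := adj.counit.naturality f
    simp only [Functor.comp_map, Functor.comp_obj, ← F.map_comp]
    exact congrArg F.map h

variable {F}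

/-- The factorization of `L ⋙ G ⟶ F` through `adjCounit`. -/
def adjLift {G : D ⥤ E} (β : L ⋙ G ⟶ F) : G ⟶ p ⋙ F where
  app X := G.map (adj.unit.app X) ≫ β.app (p.obj X)
  naturality X Y f := by
    have h : f ≫ adj.unit.app Y = adj.unit.app X ≫ L.map (p.map f) := adj.unit.naturality f
    have h' : G.map (L.map (p.map f)) ≫ β.app (p.obj Y) = β.app (p.obj X) ≫ F.map (p.map f) :=
      β.naturality (p.map f)
    calc G.map f ≫ G.map (adj.unit.app Y) ≫ β.app (p.obj Y)
        = G.map (f ≫ adj.unit.app Y) ≫ β.app (p.obj Y) := by simp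
      _ = G.map (adj.unit.app X) ≫ G.map (L.map (p.map f)) ≫ β.app (p.obj Y) := by
        rw [h, G.map_comp, Category.assoc]
      _ = _ := by rw [h']; simp

lemma adjLift_fac {G : D ⥤ E} (β : L ⋙ G ⟶ F) (X : H) :
    (adjLift adj β).app (L.obj X) ≫ (adjCounit adj F).app X = β.app X := by
  have h : G.map (L.map (adj.counit.app X)) ≫ β.app X =
    β.app (p.obj (L.obj X)) ≫ F.map (adj.counit.app X) := β.naturality (adj.counit.app X)
  calc (G.map (adj.unit.app (L.obj X)) ≫ β.app (p.obj (L.obj X))) ≫ F.map (adj.counit.app X)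
      = G.map (adj.unit.app (L.obj X) ≫ L.map (adj.counit.app X)) ≫ β.app X := by
        rw [Category.assoc, ← h, G.map_comp, Category.assoc]
    _ = _ := by
        rw [adj.right_triangle_components]
        exact (congrArg (· ≫ β.app X) (G.map_id _)).trans (Category.id_comp _)

lemma adjLift_unique {G : D ⥤ E} (γ : G ⟶ p ⋙ F) (X : D) :
    γ.app X = G.map (adj.unit.app X) ≫ γ.app (L.obj (p.obj X)) ≫
      (adjCounit adj F).app (p.obj X) := by
  have h : G.map (adj.unit.app X) ≫ γ.app (L.obj (p.obj X)) =
    γ.app X ≫ F.map (p.map (adj.unit.app X)) := γ.naturality (adj.unit.app X)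
  refine Eq.symm ((reassoc_of% h) _ |>.trans ?_)
  refine (congrArg (γ.app X ≫ ·) (F.map_comp _ _).symm).trans ?_
  refine (congrArg (fun t ↦ γ.app X ≫ F.map t) (adj.left_triangle_components X)).trans ?_
  exact (congrArg (γ.app X ≫ ·) (F.map_id _)).trans (Category.comp_id _)

variable (F)

/-- Right Kan extension along a right adjoint is precomposition with the left adjoint. -/
lemma isRightKanExtension_of_adj : (p ⋙ F).IsRightKanExtension (adjCounit adj F) where
  nonempty_isUniversal := ⟨Limits.IsTerminal.ofUniqueHom
    (fun G ↦ CostructuredArrow.homMk (adjLift adj G.hom)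
      (NatTrans.ext (funext fun X ↦ adjLift_fac adj G.hom X)))
    (fun G m ↦ CostructuredArrow.hom_ext _ _ (NatTrans.ext (funext fun X ↦
      (adjLift_unique adj m.left X).trans (congrArg (G.left.map (adj.unit.app X) ≫ ·)
        (NatTrans.congr_app (CostructuredArrow.w m) (p.obj X))))))⟩

/-- The product of two adjunctions. -/
def prodAdj {H' D' : Type*} [Category* H'] [Category* D'] {L' : H' ⥤ D'} {p' : D' ⥤ H'}
    (adj : p ⊣ L) (adj' : p' ⊣ L') : p.prod p' ⊣ L.prod L' :=
  Adjunction.mkOfHomEquiv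
    { homEquiv X Y := (adj.homEquiv X.1 Y.1).prodCongr (adj'.homEquiv X.2 Y.2)
      homEquiv_naturality_left_symm f g := Prod.ext
        (adj.homEquiv_naturality_left_symm f.1 g.1) (adj'.homEquiv_naturality_left_symm f.2 g.2)
      homEquiv_naturality_right f g := Prod.ext
        (adj.homEquiv_naturality_right f.1 g.1) (adj'.homEquiv_naturality_right f.2 g.2) }

end Kan

section HomotopyMinus

open Limits Opposite

variable {C : Type u} [Category.{v} C] [Abelian C]

lemma quasiIso_unop_aux {K L : CochainComplex Cᵒᵖ ℤ} (i : K ⟶ L) [hi : QuasiIso i] :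
    QuasiIso (((CochainComplex.opEquivalence C).inverse.map i).unop) := by
  rw [quasiIso_iff]
  intro n
  rw [quasiIsoAt_iff' _ (n - 1) n (n + 1) (by simp) (by simp)]
  have h := (quasiIsoAt_iff' i (- (n + 1)) (- n) (- (n - 1)) (by simp; ring) (by simp; ring)).1
    inferInstance
  rw [← ShortComplex.quasiIso_opMap_iff]
  exact h

/-- Every complex concentrated in degrees `≤ n` has a resolution by a complex of projectives
concentrated in degrees `≤ n`. -/
lemma exists_quasiIso_projective [EnoughProjectives C] (K : CochainComplex C ℤ) (n : ℤ)
    [K.IsStrictlyLE n] :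
    ∃ (P : CochainComplex C ℤ) (p : P ⟶ K), QuasiIso p ∧ (∀ i, Projective (P.X i)) ∧
      P.IsStrictlyLE n := by
  let e := CochainComplex.opEquivalence C
  have h : (e.functor.obj (op K)).IsStrictlyGE (-n) := by
    rw [CochainComplex.isStrictlyGE_iff]
    intro i hi
    exact (K.isZero_of_isStrictlyLE n (-i) (by lia)).op
  obtain ⟨L, i, hi, hL, hL'⟩ :=
    CochainComplex.Plus.modelCategoryQuillen.exists_quasiIso_injective (e.functor.obj (op K)) (-n)
  have := quasiIso_unop_aux i
  refine ⟨(e.inverse.obj L).unop, (e.inverse.map i).unop ≫ (e.unitIso.app (op K)).hom.unop,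
    ?_, fun j ↦ ?_, ?_⟩
  · have : IsIso (e.unitIso.app (op K)).hom.unop := inferInstance
    infer_instance
  · exact inferInstanceAs (Projective (unop (L.X (-j))))
  · rw [CochainComplex.isStrictlyLE_iff]
    intro j hj
    exact (L.isZero_of_isStrictlyGE (-n) (-j) (by lia)).unop

variable (C) in
/-- The complexes that vanish in all large degrees. -/
def isMinus : ObjectProperty (HomotopyCategory C (.up ℤ)) := fun K ↦
  ∃ n, CochainComplex.IsStrictlyLE (C := C) K.as n

variable (C) in
/-- The complexes of projective objects that vanish in all large degrees. -/
def isProj : ObjectProperty (HomotopyCategory C (.up ℤ)) := fun K ↦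
  (∃ n, CochainComplex.IsStrictlyLE (C := C) K.as n) ∧ ∀ i, Projective (K.as.X i)

variable (C) in
/-- The homotopy category `K⁻(C)` of bounded above complexes. -/
abbrev HMinus := (isMinus C).FullSubcategory

variable (C) in
/-- The homotopy category `K⁻(Proj C)` of bounded above complexes of projectives. -/
abbrev HMinusProj := (isProj C).FullSubcategory

variable (C) in
/-- The inclusion `K⁻(Proj C) ⥤ K⁻(C)`. -/
def projInclusion : HMinusProj C ⥤ HMinus C := ObjectProperty.ιOfLE fun _ h ↦ h.1

variable (C) in
instance : (projInclusion C).Full := (ObjectProperty.fullyFaithfulιOfLE _).full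
variable (C) in
instance : (projInclusion C).Faithful := (ObjectProperty.fullyFaithfulιOfLE _).faithful

lemma isKProjective_of_isProj (K : HMinusProj C) :
    CochainComplex.IsKProjective K.1.as := by
  obtain ⟨⟨n, hn⟩, h⟩ := K.2
  exact CochainComplex.isKProjective_of_projective _ n

section
variable [HasDerivedCategory C]

variable (C) in
/-- The canonical functor `K⁻(C) ⥤ D⁻(C)`. -/
def toMinus : HMinus C ⥤ DerivedCategory.Minus C :=
  ObjectProperty.lift _ ((isMinus C).ι ⋙ DerivedCategory.Qh) fun K ↦ by
    obtain ⟨K, n, hn⟩ := K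
    obtain ⟨K, rfl⟩ := HomotopyCategory.quotient_obj_surjective K
    have : CochainComplex.IsStrictlyLE (C := C) K n := hn
    have : (DerivedCategory.Q.obj K).IsLE n := inferInstance
    exact ⟨n, (DerivedCategory.TStructure.t.isLE_of_iso
      ((DerivedCategory.quotientCompQhIso C).symm.app K) n)⟩

lemma toMinus_map_bijective (P : HMinusProj C) (L : HMinus C) :
    Function.Bijective ((toMinus C).map : ((projInclusion C).obj P ⟶ L) → _) := by
  have := isKProjective_of_isProj P
  have h := CochainComplex.IsKProjective.Qh_map_bijective P.1.as L.1
  rw [← Function.Bijective.of_comp_iff'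
    (DerivedCategory.TStructure.t.minus.fullyFaithfulι.map_bijective _ _)]
  exact h.comp ((isMinus C).fullyFaithfulι.map_bijective _ _)

instance : (projInclusion C ⋙ toMinus C).Faithful where
  map_injective {X _ _ _} h :=
    (projInclusion C).map_injective ((toMinus_map_bijective X _).1 h)

instance : (projInclusion C ⋙ toMinus C).Full where
  map_surjective {X Y} f := by
    obtain ⟨g, rfl⟩ := (toMinus_map_bijective X _).2 f
    obtain ⟨g, rfl⟩ := (projInclusion C).map_surjective g
    exact ⟨g, rfl⟩

variable [EnoughProjectives C]

instance : (projInclusion C ⋙ toMinus C).EssSurj where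
  mem_essImage X := by
    obtain ⟨X, n, hX⟩ := X
    have : X.IsLE n := hX
    obtain ⟨K, _, ⟨e⟩⟩ := X.exists_iso_Q_obj_of_isLE n
    obtain ⟨P, p, _, hP, hP'⟩ := exists_quasiIso_projective K n
    refine ⟨⟨(HomotopyCategory.quotient C (.up ℤ)).obj P, ⟨n, hP'⟩, hP⟩,
      ⟨DerivedCategory.Minus.ι.preimageIso (?_ ≪≫ e.symm)⟩⟩
    exact (DerivedCategory.quotientCompQhIso C).app P ≪≫ asIso (DerivedCategory.Q.map p)

instance : (projInclusion C ⋙ toMinus C).IsEquivalence where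

variable (C) in
/-- The projective resolution functor `D⁻(C) ⥤ K⁻(C)`: the inverse of the equivalence
`K⁻(Proj C) ≌ D⁻(C)`, followed by the inclusion. -/
def projRes : DerivedCategory.Minus C ⥤ HMinus C :=
  (projInclusion C ⋙ toMinus C).inv ⋙ projInclusion C

variable (C) in
/-- A projective resolution of `X` is isomorphic to `X` in `D⁻(C)`. -/
def projResIso : projRes C ⋙ toMinus C ≅ 𝟭 _ :=
  (projInclusion C ⋙ toMinus C).asEquivalence.counitIso

variable (C) in
/-- Morphisms out of `X` in `D⁻(C)` are homotopy classes of maps out of a projective resolution. -/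
def projResHomEquiv (X : DerivedCategory.Minus C) (L : HMinus C) :
    ((projRes C).obj X ⟶ L) ≃ (X ⟶ (toMinus C).obj L) :=
  (Equiv.ofBijective _ (toMinus_map_bijective _ L)).trans ((projResIso C).app X).homFromEquiv

lemma projResHomEquiv_apply {X : DerivedCategory.Minus C} {L : HMinus C}
    (f : (projRes C).obj X ⟶ L) :
    projResHomEquiv C X L f = (projResIso C).inv.app X ≫ (toMinus C).map f := rfl

variable (C) in
/-- The projective resolution functor is left adjoint to `K⁻(C) ⥤ D⁻(C)`. -/
def projResAdj : projRes C ⊣ toMinus C :=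
  Adjunction.mkOfHomEquiv
    { homEquiv X L := projResHomEquiv C X L
      homEquiv_naturality_left_symm f g := by
        rw [Equiv.symm_apply_eq, projResHomEquiv_apply, Functor.map_comp]
        have h := (projResIso C).inv.naturality_assoc f
          ((toMinus C).map ((projResHomEquiv C _ _).symm g))
        refine Eq.trans ?_ h
        congr 1
        exact ((projResHomEquiv C _ _).apply_symm_apply g).symm
      homEquiv_naturality_right f g := by
        rw [projResHomEquiv_apply, projResHomEquiv_apply, Functor.map_comp, Category.assoc] }
end

section
variable {D : Type*} [Category* D] [Abelian D] (F : C ⥤ D) [F.Additive]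

/-- The functor `K⁻(C) ⥤ K⁻(D)` given by applying an additive functor in each degree. -/
def mapMinus : HMinus C ⥤ HMinus D :=
  ObjectProperty.lift _ ((isMinus C).ι ⋙ F.mapHomotopyCategory _) fun K ↦ by
    obtain ⟨n, hn⟩ := K.2
    exact ⟨n, inferInstanceAs (CochainComplex.IsStrictlyLE
      ((F.mapHomologicalComplex (.up ℤ)).obj K.1.as) n)⟩

variable [HasDerivedCategory C] [HasDerivedCategory D] [EnoughProjectives C]

/-- The left derived functor `D⁻(C) ⥤ D⁻(D)` of an additive functor `F : C ⥤ D`: apply `F` to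
projective resolutions. -/
def leftDerivedMinus : DerivedCategory.Minus C ⥤ DerivedCategory.Minus D :=
  projRes C ⋙ mapMinus F ⋙ toMinus D

/-- The canonical morphism from the left derived functor of `F` to `F` itself. -/
def leftDerivedMinusCounit :
    toMinus C ⋙ leftDerivedMinus F ⟶ mapMinus F ⋙ toMinus D :=
  adjCounit (projResAdj C) (mapMinus F ⋙ toMinus D)

/-- `leftDerivedMinus F` has the universal property of the total left derived functor. -/
instance leftDerivedMinus_isRightKanExtension :
    (leftDerivedMinus F).IsRightKanExtension (leftDerivedMinusCounit F) :=
  isRightKanExtension_of_adj (projResAdj C) (mapMinus F ⋙ toMinus D)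

end

section
variable {C₁ C₂ D : Type*} [Category* C₁] [Category* C₂] [Category* D] [Abelian C₁] [Abelian C₂]
  [Abelian D] [HasCoproducts.{0} D] (F : C₁ ⥤ C₂ ⥤ D) [F.Additive] [∀ X, (F.obj X).Additive]

instance (K : CochainComplex C₁ ℤ) (L : CochainComplex C₂ ℤ) :
    HomologicalComplex.HasMapBifunctor K L F (.up ℤ) := fun i ↦ by
    infer_instance

instance mapBifunctor_isStrictlyLE (K : CochainComplex C₁ ℤ) (L : CochainComplex C₂ ℤ) (m n : ℤ)
    [K.IsStrictlyLE m] [L.IsStrictlyLE n] :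
    CochainComplex.IsStrictlyLE (HomologicalComplex.mapBifunctor K L F (.up ℤ)) (m + n) := by
  rw [CochainComplex.isStrictlyLE_iff]
  intro k hk
  rw [IsZero.iff_id_eq_zero]
  refine HomologicalComplex.mapBifunctor.hom_ext fun i j hij ↦ ?_
  have hij : i + j = k := hij
  refine IsZero.eq_of_src ?_ _ _
  by_cases hi : m < i
  · have := K.isZero_of_isStrictlyLE m i
    exact ((F.map_isZero this).obj _)
  · have := L.isZero_of_isStrictlyLE n j (by lia)
    exact (F.obj _).map_isZero this

/-- For a complex `K`, the functor on homotopy categories sending `L` to the total complex of the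
bicomplex `F(Kⁱ, Lʲ)`. -/
def map₂HomotopyObj (K : CochainComplex C₁ ℤ) :
    HomotopyCategory C₂ (.up ℤ) ⥤ HomotopyCategory D (.up ℤ) :=
  CategoryTheory.Quotient.lift _
    ((F.map₂CochainComplex.obj K) ⋙ HomotopyCategory.quotient D (.up ℤ))
    (by
      rintro L L' f g ⟨h⟩
      exact HomotopyCategory.eq_of_homotopy _ _
        (HomologicalComplex.mapBifunctorMapHomotopy₂ (𝟙 K) h F (.up ℤ)))

/-- The bifunctor on homotopy categories sending `(K, L)` to the total complex of the bicomplex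
`F(Kⁱ, Lʲ)`. -/
def map₂HomotopyCategory :
    HomotopyCategory C₁ (.up ℤ) ⥤ HomotopyCategory C₂ (.up ℤ) ⥤ HomotopyCategory D (.up ℤ) :=
  CategoryTheory.Quotient.lift _
    { obj K := map₂HomotopyObj F K
      map f := CategoryTheory.Quotient.natTransLift _
        (Functor.whiskerRight (F.map₂CochainComplex.map f) (HomotopyCategory.quotient D (.up ℤ)))
      map_id K := by
        refine CategoryTheory.Quotient.natTrans_ext _ _ ?_
        ext L
        exact (congrArg (HomotopyCategory.quotient D (.up ℤ)).map
          (NatTrans.congr_app (F.map₂CochainComplex.map_id K) L)).trans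
            ((HomotopyCategory.quotient D (.up ℤ)).map_id _)
      map_comp f g := by
        refine CategoryTheory.Quotient.natTrans_ext _ _ ?_
        ext L
        exact (congrArg (HomotopyCategory.quotient D (.up ℤ)).map
          (NatTrans.congr_app (F.map₂CochainComplex.map_comp f g) L)).trans
            ((HomotopyCategory.quotient D (.up ℤ)).map_comp _ _) }
    (by
      rintro K K' f g ⟨h⟩
      refine CategoryTheory.Quotient.natTrans_ext _ _ ?_
      ext L
      exact HomotopyCategory.eq_of_homotopy _ _
        (HomologicalComplex.mapBifunctorMapHomotopy₁ h (𝟙 L) F (.up ℤ)))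

/-- The functor `K⁻(C₁) × K⁻(C₂) ⥤ K⁻(D)` sending `(K, L)` to the total complex of `F(Kⁱ, Lʲ)`. -/
def map₂Minus : HMinus C₁ × HMinus C₂ ⥤ HMinus D :=
  ObjectProperty.lift _ (((isMinus C₁).ι.prod (isMinus C₂).ι) ⋙
    Functor.uncurry.obj (map₂HomotopyCategory F)) fun ⟨⟨K, m, _⟩, ⟨L, n, _⟩⟩ ↦
      ⟨m + n, mapBifunctor_isStrictlyLE F K.as L.as m n⟩

variable [HasDerivedCategory C₁] [HasDerivedCategory C₂] [HasDerivedCategory D]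
  [EnoughProjectives C₁] [EnoughProjectives C₂]

/-- The left derived functor `D⁻(C₁) × D⁻(C₂) ⥤ D⁻(D)` of an additive bifunctor `F`: apply `F` to
projective resolutions of both arguments and take total complexes. -/
def leftDerived₂Minus :
    DerivedCategory.Minus C₁ × DerivedCategory.Minus C₂ ⥤ DerivedCategory.Minus D :=
  (projRes C₁).prod (projRes C₂) ⋙ map₂Minus F ⋙ toMinus D

/-- The canonical morphism from the left derived functor of the bifunctor `F` to `F` itself. -/
def leftDerived₂MinusCounit :
    (toMinus C₁).prod (toMinus C₂) ⋙ leftDerived₂Minus F ⟶ map₂Minus F ⋙ toMinus D :=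
  adjCounit (prodAdj (projResAdj C₁) (projResAdj C₂)) (map₂Minus F ⋙ toMinus D)

/-- `leftDerived₂Minus F` has the universal property of the total left derived functor. -/
instance leftDerived₂Minus_isRightKanExtension :
    (leftDerived₂Minus F).IsRightKanExtension (leftDerived₂MinusCounit F) :=
  isRightKanExtension_of_adj (prodAdj (projResAdj C₁) (projResAdj C₂)) (map₂Minus F ⋙ toMinus D)

end

end HomotopyMinus

section Action
variable (K : Type u) [CommRing K] {R : Type u} [Ring R] [Algebra K R]

/-- A module over a `K`-algebra `R` is a `K`-module through `K → R`. -/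
abbrev baseModule (M : ModuleCat.{u} R) : Module K M := Module.restrictScalars K R M

attribute [local instance] baseModule

lemma baseModule_tower (M : ModuleCat.{u} R) : IsScalarTower K R M :=
  IsScalarTower.restrictScalars K R M

attribute [local instance] baseModule_tower

variable {K}

/-- The `K`-linear map underlying a morphism of `R`-modules. -/
def linOver {M N : ModuleCat.{u} R} (f : M ⟶ N) : M →ₗ[K] N := f.hom.restrictScalars K

end Action
attribute [local instance] baseModule baseModule_tower

section Tensor
variable (K : Type u) [CommRing K] (A B C : Type u) [Ring A] [Ring B] [Ring C]
  [Algebra K A] [Algebra K B] [Algebra K C]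

/-- The category of `A`-`B`-bimodules relative to `K`, i.e. of `A ⊗ Bᵒᵖ`-modules. -/
abbrev Bimod := ModuleCat.{u} (A ⊗[K] Bᵐᵒᵖ)

variable {K A B C}

/-- The left action of `A` on a bimodule: `a • m = (a ⊗ 1) m`. -/
def leftAct (M : Bimod K A B) : A →ₐ[K] Module.End K M :=
  (Algebra.lsmul K K M).comp (Algebra.TensorProduct.includeLeft (R := K) (S := K) (A := A) (B := Bᵐᵒᵖ))

/-- The right action of `B` on a bimodule: `m b = (1 ⊗ b) m`. -/
def rightAct (M : Bimod K A B) : Bᵐᵒᵖ →ₐ[K] Module.End K M :=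
  (Algebra.lsmul K K M).comp (Algebra.TensorProduct.includeRight (R := K) (A := A) (B := Bᵐᵒᵖ))

lemma leftAct_comm (M : Bimod K A B) (a : A) (b : Bᵐᵒᵖ) :
    Commute (leftAct M a) (rightAct M b) :=
  ((Commute.one_right a).tmul (Commute.one_left b)).map (Algebra.lsmul K K M)

/-- The underlying group of `M ⊗_K N`, seen as an `A`-`C`-bimodule through
`a (m ⊗ n) c = a m ⊗ n c`. -/
def Outer (M : Bimod K A B) (N : Bimod K B C) : Type u := M ⊗[K] N

instance (M : Bimod K A B) (N : Bimod K B C) : AddCommGroup (Outer M N) :=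
  inferInstanceAs (AddCommGroup (M ⊗[K] N))

/-- The action of `A ⊗ Cᵒᵖ` on `M ⊗_K N`. -/
def outerAct (M : Bimod K A B) (N : Bimod K B C) :
    A ⊗[K] Cᵐᵒᵖ →ₐ[K] Module.End K (M ⊗[K] N) :=
  Module.endTensorEndAlgHom.comp (Algebra.TensorProduct.map (leftAct M) (rightAct N))

instance (M : Bimod K A B) (N : Bimod K B C) :
    Module (A ⊗[K] Cᵐᵒᵖ) (Outer M N) :=
  Module.compHom (M ⊗[K] N) (outerAct M N).toRingHom

lemma outer_smul (M : Bimod K A B) (N : Bimod K B C) (a : A) (c : Cᵐᵒᵖ) (m : M) (n : N) :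
   ((a ⊗ₜ[K] c) • (show Outer M N from m ⊗ₜ[K] n)) = (show Outer M N from leftAct M a m ⊗ₜ[K] rightAct N c n) := rfl

/-- The sub-bimodule of `M ⊗_K N` generated by all `m b ⊗ n - m ⊗ b n`. -/
def balancedRel (M : Bimod K A B) (N : Bimod K B C) : Submodule (A ⊗[K] Cᵐᵒᵖ) (Outer M N) :=
  Submodule.span _ (Set.range fun x : M × B × N ↦
    (show Outer M N from
      rightAct M (MulOpposite.op x.2.1) x.1 ⊗ₜ[K] x.2.2 - x.1 ⊗ₜ[K] leftAct N x.2.1 x.2.2))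

lemma linOver_leftAct {M M' : Bimod K A B} (f : M ⟶ M') (a : A) (m : M) :
    linOver (K := K) f (leftAct M a m) = leftAct M' a (linOver (K := K) f m) :=
  f.hom.map_smul _ _

lemma linOver_rightAct {M M' : Bimod K A B} (f : M ⟶ M') (b : Bᵐᵒᵖ) (m : M) :
    linOver (K := K) f (rightAct M b m) = rightAct M' b (linOver (K := K) f m) :=
  f.hom.map_smul _ _

/-- The map of bimodules `f ⊗ g` on `M ⊗_K N`. -/
def outerMap {M M' : Bimod K A B} {N N' : Bimod K B C} (f : M ⟶ M') (g : N ⟶ N') :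
    Outer M N →ₗ[A ⊗[K] Cᵐᵒᵖ] Outer M' N' where
  toFun := TensorProduct.map (linOver (K := K) f) (linOver (K := K) g)
  map_add' := map_add (TensorProduct.map (linOver (K := K) f) (linOver (K := K) g))
  map_smul' r x := by
    change TensorProduct.map _ _ (outerAct M N r x) =
      outerAct M' N' r (TensorProduct.map (linOver (K := K) f) (linOver (K := K) g) x)
    change M ⊗[K] N at x
    induction r with
    | zero => simp
    | add r s hr hs => simp [hr, hs]
    | tmul a c =>
      induction x with
      | zero => simp
      | add x y hx hy => rw [map_add, map_add, map_add, map_add, hx, hy]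
      | tmul m n =>
        change (linOver (K := K) f (leftAct M a m)) ⊗ₜ[K] (linOver (K := K) g (rightAct N c n)) =
          leftAct M' a (linOver (K := K) f m) ⊗ₜ[K] rightAct N' c (linOver (K := K) g n)
        rw [linOver_leftAct, linOver_rightAct]

lemma balancedRel_le {M M' : Bimod K A B} {N N' : Bimod K B C} (f : M ⟶ M') (g : N ⟶ N') :
    balancedRel M N ≤ (balancedRel M' N').comap (outerMap f g) := by
  refine Submodule.span_le.2 ?_
  rintro _ ⟨⟨m, b, n⟩, rfl⟩
  refine Submodule.subset_span ⟨(linOver (K := K) f m, b, linOver (K := K) g n), ?_⟩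
  change _ = TensorProduct.map (linOver (K := K) f) (linOver (K := K) g) (_ - _)
  rw [map_sub, TensorProduct.map_tmul, TensorProduct.map_tmul, linOver_leftAct, linOver_rightAct]

/-- The bimodule `M ⊗_B N`: the quotient of `M ⊗_K N` by all `m b ⊗ n - m ⊗ b n`. -/
def tensorObj (M : Bimod K A B) (N : Bimod K B C) : Bimod K A C :=
  ModuleCat.of _ (Outer M N ⧸ balancedRel M N)

/-- The map `f ⊗ g` on `M ⊗_B N`. -/
def tensorMap {M M' : Bimod K A B} {N N' : Bimod K B C} (f : M ⟶ M') (g : N ⟶ N') :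
    tensorObj M N ⟶ tensorObj M' N' :=
  ModuleCat.ofHom (Submodule.mapQ _ _ (outerMap f g) (balancedRel_le f g))

/-- The element `m ⊗ n` of `M ⊗_B N`. -/
def tensorMk {M : Bimod K A B} {N : Bimod K B C} (m : M) (n : N) : tensorObj M N :=
  Submodule.Quotient.mk (show Outer M N from m ⊗ₜ[K] n)

lemma tensorMap_mk {M M' : Bimod K A B} {N N' : Bimod K B C} (f : M ⟶ M') (g : N ⟶ N')
    (m : M) (n : N) : (tensorMap f g).hom (tensorMk m n) = tensorMk (f.hom m) (g.hom n) := rfl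

lemma tensor_hom_ext {M : Bimod K A B} {N : Bimod K B C} {Z : Bimod K A C}
    {φ ψ : tensorObj M N ⟶ Z} (h : ∀ m n, φ.hom (tensorMk m n) = ψ.hom (tensorMk m n)) : φ = ψ := by
  refine ModuleCat.hom_ext (Submodule.linearMap_qext _ (LinearMap.ext fun x ↦ ?_))
  change M ⊗[K] N at x
  induction x with
  | zero => exact (map_zero _).trans (map_zero _).symm
  | tmul m n => exact h m n
  | add x y hx hy => exact (map_add _ _ _).trans ((congrArg₂ (· + ·) hx hy).trans (map_add _ _ _).symm)

lemma tensorMk_add_left {M : Bimod K A B} {N : Bimod K B C} (m m' : M) (n : N) :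
    tensorMk (m + m') n = tensorMk m n + tensorMk m' n :=
  congrArg (Submodule.Quotient.mk (p := balancedRel M N)) (TensorProduct.add_tmul m m' n)

lemma tensorMk_add_right {M : Bimod K A B} {N : Bimod K B C} (m : M) (n n' : N) :
    tensorMk m (n + n') = tensorMk m n + tensorMk m n' :=
  congrArg (Submodule.Quotient.mk (p := balancedRel M N)) (TensorProduct.tmul_add m n n')

variable (K A B C)

/-- The bifunctor `- ⊗_B -` from `A`-`B`-bimodules and `B`-`C`-bimodules to `A`-`C`-bimodules. -/
def tensorFunctor : Bimod K A B ⥤ Bimod K B C ⥤ Bimod K A C where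
  obj M :=
    { obj N := tensorObj M N
      map g := tensorMap (𝟙 M) g
      map_id _ := tensor_hom_ext fun _ _ ↦ rfl
      map_comp _ _ := tensor_hom_ext fun _ _ ↦ rfl }
  map f :=
    { app N := tensorMap f (𝟙 N)
      naturality _ _ _ := tensor_hom_ext fun _ _ ↦ rfl }
  map_id _ := by ext N : 2; exact tensor_hom_ext fun _ _ ↦ rfl
  map_comp _ _ := by ext N : 2; exact tensor_hom_ext fun _ _ ↦ rfl

instance : (tensorFunctor K A B C).Additive where
  map_add := by
    intros
    ext N : 2
    exact tensor_hom_ext fun _ _ ↦ tensorMk_add_left _ _ _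

instance (M : Bimod K A B) : ((tensorFunctor K A B C).obj M).Additive where
  map_add := tensor_hom_ext fun _ _ ↦ tensorMk_add_right _ _ _

end Tensor

section BaseChange
variable (K K' : Type u) [CommRing K] [CommRing K'] [Algebra K K'] {A B : Type u} [Ring A] [Ring B]
  [Algebra K A] [Algebra K B]

variable {K}
/-- The left action `(x ⊗ a) (z ⊗ m) = x z ⊗ a m` of the base change of `A`. -/
def baseLeftAct (M : Bimod K A B) : K' ⊗[K] A →ₐ[K'] Module.End K' (K' ⊗[K] M) :=
  Algebra.TensorProduct.lift (Algebra.ofId K' _)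
    ((Module.End.baseChangeHom K K' M).comp (leftAct M)) fun x _ ↦ Algebra.commutes x _

/-- The right action `(z ⊗ m) (y ⊗ b) = y z ⊗ m b` of the base change of `B`. -/
def baseRightAct (M : Bimod K A B) : (K' ⊗[K] B)ᵐᵒᵖ →ₐ[K'] Module.End K' (K' ⊗[K] M) :=
  AlgHom.opComm (Algebra.TensorProduct.lift (Algebra.ofId K' _)
    (AlgHom.opComm.symm ((Module.End.baseChangeHom K K' M).comp (rightAct M)))
      fun x _ ↦ Algebra.commutes x _)

lemma baseLeftAct_apply (M : Bimod K A B) (x y : K') (a : A) (m : M) :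
    baseLeftAct K' M (x ⊗ₜ a) (y ⊗ₜ m) = (x * y) ⊗ₜ leftAct M a m := rfl

lemma baseRightAct_apply (M : Bimod K A B) (x y : K') (b : B) (m : M) :
    baseRightAct K' M (MulOpposite.op (x ⊗ₜ b)) (y ⊗ₜ m) = (x * y) ⊗ₜ rightAct M (MulOpposite.op b) m := rfl

lemma baseAct_comm (M : Bimod K A B) (a : K' ⊗[K] A) (b : (K' ⊗[K] B)ᵐᵒᵖ) :
    Commute (baseLeftAct K' M a) (baseRightAct K' M b) := by
  induction b using MulOpposite.rec' with | _ b
  induction b with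
  | zero => rw [MulOpposite.op_zero, map_zero]; exact Commute.zero_right _
  | add x y hx hy => rw [MulOpposite.op_add, map_add]; exact hx.add_right hy
  | tmul y b =>
    induction a with
    | zero => rw [map_zero]; exact Commute.zero_left _
    | add x y hx hy => rw [map_add]; exact hx.add_left hy
    | tmul x a =>
      refine LinearMap.ext fun t ↦ ?_
      induction t with
      | zero => simp
      | add t s ht hs => rw [map_add, map_add, ht, hs]
      | tmul z m =>
        simp only [Module.End.mul_apply, baseLeftAct_apply, baseRightAct_apply]
        rw [mul_left_comm]
        exact congrArg _ (LinearMap.congr_fun (leftAct_comm M a (MulOpposite.op b)) m)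

/-- Both actions combined. -/
def baseAct (M : Bimod K A B) :
    (K' ⊗[K] A) ⊗[K'] (K' ⊗[K] B)ᵐᵒᵖ →ₐ[K'] Module.End K' (K' ⊗[K] M) :=
  Algebra.TensorProduct.lift (baseLeftAct K' M) (baseRightAct K' M) (baseAct_comm K' M)

/-- The underlying group of the base change of the bimodule `M`. -/
def BaseExt (M : Bimod K A B) : Type u := K' ⊗[K] M

instance (M : Bimod K A B) : AddCommGroup (BaseExt K' M) :=
  inferInstanceAs (AddCommGroup (K' ⊗[K] M))

instance (M : Bimod K A B) : Module ((K' ⊗[K] A) ⊗[K'] (K' ⊗[K] B)ᵐᵒᵖ) (BaseExt K' M) :=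
  Module.compHom (K' ⊗[K] M) (baseAct K' M).toRingHom

lemma baseExt_smul (M : Bimod K A B) (x y z : K') (a : A) (b : B) (m : M) :
    ((x ⊗ₜ[K] a) ⊗ₜ[K'] MulOpposite.op (y ⊗ₜ[K] b)) • (show BaseExt K' M from z ⊗ₜ[K] m) =
      (show BaseExt K' M from (x * (y * z)) ⊗ₜ[K] leftAct M a (rightAct M (MulOpposite.op b) m)) := rfl

/-- The base change of a morphism of bimodules. -/
def baseMap {M N : Bimod K A B} (f : M ⟶ N) :
    BaseExt K' M →ₗ[(K' ⊗[K] A) ⊗[K'] (K' ⊗[K] B)ᵐᵒᵖ] BaseExt K' N where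
  toFun := (linOver (K := K) f).baseChange K'
  map_add' := map_add ((linOver (K := K) f).baseChange K')
  map_smul' r t := by
    change (linOver (K := K) f).baseChange K' (baseAct K' M r t) =
      baseAct K' N r ((linOver (K := K) f).baseChange K' t)
    change K' ⊗[K] M at t
    induction r with
    | zero => simp
    | add r s hr hs => simp [hr, hs]
    | tmul a b =>
      induction b using MulOpposite.rec' with | _ b
      induction b with
      | zero => simp
      | add x y hx hy => simp only [MulOpposite.op_add, TensorProduct.tmul_add, map_add, LinearMap.add_apply, hx, hy]
      | tmul y b =>
        induction a with
        | zero => simp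
        | add x y hx hy => simp only [TensorProduct.add_tmul, map_add, LinearMap.add_apply, hx, hy]
        | tmul x a =>
          induction t with
          | zero => simp
          | add t s ht hs => simp only [map_add, ht, hs]
          | tmul z m =>
            change (x * (y * z)) ⊗ₜ[K] linOver (K := K) f (leftAct M a (rightAct M (MulOpposite.op b) m)) =
              (x * (y * z)) ⊗ₜ[K] leftAct N a (rightAct N (MulOpposite.op b) (linOver (K := K) f m))
            rw [linOver_leftAct, linOver_rightAct]

variable (K A B)

/-- The functor sending an `A`-`B`-bimodule relative to `K` to its base change along `K → K'`, a
bimodule over the base changes of `A` and `B`, relative to `K'`. -/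
def baseChangeFunctor : Bimod K A B ⥤ Bimod K' (K' ⊗[K] A) (K' ⊗[K] B) where
  obj M := ModuleCat.of _ (BaseExt K' M)
  map f := ModuleCat.ofHom (baseMap K' f)
  map_id M := ModuleCat.hom_ext (LinearMap.ext fun t ↦
    (LinearMap.congr_fun (LinearMap.baseChange_id (R := K) (A := K') (M := M)) t))
  map_comp f g := ModuleCat.hom_ext (LinearMap.ext fun t ↦
    (LinearMap.congr_fun (LinearMap.baseChange_comp (A := K') (linOver (K := K) f) (linOver (K := K) g)) t))

instance : (baseChangeFunctor K K' A B).Additive where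
  map_add {_ _ f g} := ModuleCat.hom_ext (LinearMap.ext fun t ↦
    (LinearMap.congr_fun (LinearMap.baseChange_add (A := K') (linOver (K := K) f) (linOver (K := K) g)) t))

end BaseChange

section Derived

instance (R : Type u) [Ring R] : HasDerivedCategory (ModuleCat.{u} R) :=
  HasDerivedCategory.standard _

/-- The bounded above derived category `D⁻(Mod A ⊗_K Bᵒᵖ)`. -/
abbrev DMinus (K A B : Type u) [CommRing K] [Ring A] [Ring B] [Algebra K A] [Algebra K B] :=
  DerivedCategory.Minus (Bimod K A B)

/-- The derived tensor product `- ⊗ᴸ_B -`: the left derived functor of the bifunctor `- ⊗_B -` on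
bimodules. -/
def derivedTensor (K A B C : Type u) [CommRing K] [Ring A] [Ring B] [Ring C]
    [Algebra K A] [Algebra K B] [Algebra K C] :
    DMinus K A B × DMinus K B C ⥤ DMinus K A C :=
  leftDerived₂Minus (tensorFunctor K A B C)

/-- Derived base change along `K → K'`, the left derived functor of base change of bimodules. -/
def derivedBaseChange (K K' A B : Type u) [CommRing K] [CommRing K'] [Algebra K K']
    [Ring A] [Ring B] [Algebra K A] [Algebra K B] :
    DMinus K A B ⥤ DMinus K' (K' ⊗[K] A) (K' ⊗[K] B) :=
  leftDerivedMinus (baseChangeFunctor K K' A B)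

end Derived

end DerivedBimod

end

/-! Write `G` for base change of bimodules along `K → K'`. Derived functors are evaluated on bounded
above projective resolutions `P → M` and `Q → N`, so both sides are compared with `G (Tot (P ⊗_B
Q))`.

For the left side, `G` is left adjoint to restriction of scalars (`baseChangeAdj`), which preserves
epimorphisms, so `G` preserves projectives. Hence `G P` and `G Q` are projective resolutions of `M'`
and `N'` (`projResMapMinusIso`), and the left side is `Tot (G P ⊗_{B'} G Q)`. The underived
isomorphism `M' ⊗_{B'} N' ≅ (M ⊗_B N)'` is natural (`baseChangeTensorComp`), and `G` commutes with
the coproducts that form total complexes, so this complex is `G (Tot (P ⊗_B Q))` (`minusCompIso`).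

The right side is `G` of a projective resolution `X` of `Tot (P ⊗_B Q)`. That total complex need not
consist of projectives, and this is where flatness enters. The terms of `X` are `K`-flat because `A
⊗ Cᵒᵖ` is. The terms of `Q` are `K`-flat because `B ⊗ Cᵒᵖ` is, and then `P ⊗_B Q` is a retract of
sums of modules `A ⊗_K Q`, hence `K`-flat as well (`flat_tensorObj`). The cone of `X → Tot (P ⊗_B
Q)` is therefore a bounded above acyclic complex of `K`-flat modules. It stays exact under `K' ⊗_K
-` (`lTensor_exact_of_flat`), so `G` preserves this quasi-isomorphism
(`isIso_leftDerived_baseChange_counit`).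

The formal part is `leftDerivedCompIso`, stated for arbitrary additive bifunctors. -/

noncomputable section

namespace DerivedBimod

/-! ### Total complexes under functors that preserve coproducts -/

section MapTotal

open Limits HomologicalComplex

variable {C₁ C₂ D C₁' C₂' D' : Type*} [Category* C₁] [Category* C₂] [Category* D]
  [Category* C₁'] [Category* C₂'] [Category* D'] [Abelian C₁] [Abelian C₂] [Abelian D]
  [Abelian C₁'] [Abelian C₂'] [Abelian D'] [HasCoproducts.{0} D] [HasCoproducts.{0} D']
  {F : C₁ ⥤ C₂ ⥤ D} [F.Additive] [∀ X, (F.obj X).Additive]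
  {F' : C₁' ⥤ C₂' ⥤ D'} [F'.Additive] [∀ X, (F'.obj X).Additive]
  {G₁ : C₁ ⥤ C₁'} {G₂ : C₂ ⥤ C₂'} {G : D ⥤ D'} [G₁.Additive] [G₂.Additive] [G.Additive]

variable (F F' G₁ G₂ G) in
/-- A natural isomorphism `F'(G₁ X, G₂ Y) ≅ G (F(X, Y))`. -/
structure BifunctorComp where
  /-- the isomorphisms -/
  iso (X : C₁) (Y : C₂) : (F'.obj (G₁.obj X)).obj (G₂.obj Y) ≅ G.obj ((F.obj X).obj Y)
  naturality_left {X X' : C₁} (f : X ⟶ X') (Y : C₂) :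
    (F'.map (G₁.map f)).app (G₂.obj Y) ≫ (iso X' Y).hom =
      (iso X Y).hom ≫ G.map ((F.map f).app Y)
  naturality_right (X : C₁) {Y Y' : C₂} (g : Y ⟶ Y') :
    (F'.obj (G₁.obj X)).map (G₂.map g) ≫ (iso X Y').hom =
      (iso X Y).hom ≫ G.map ((F.obj X).map g)

variable (e : BifunctorComp F F' G₁ G₂ G)

/-- The total complex of `F'(G₁ Kⁱ, G₂ Lʲ)`. -/
abbrev totalMap (F' : C₁' ⥤ C₂' ⥤ D') [F'.Additive] [∀ X, (F'.obj X).Additive]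
    (G₁ : C₁ ⥤ C₁') (G₂ : C₂ ⥤ C₂') [G₁.Additive] [G₂.Additive]
    (K : CochainComplex C₁ ℤ) (L : CochainComplex C₂ ℤ) : CochainComplex D' ℤ :=
  mapBifunctor ((G₁.mapHomologicalComplex (.up ℤ)).obj K)
    ((G₂.mapHomologicalComplex (.up ℤ)).obj L) F' (.up ℤ)

/-- The signs depend only on the bidegree `(i, j)`, not on the bifunctor; this is what lets the
differentials for `F` and `F'` be matched summand by summand. -/
lemma ι_mapBifunctor_d (K : CochainComplex C₁ ℤ) (L : CochainComplex C₂ ℤ) (i j n n' : ℤ)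
    (h : ComplexShape.π (.up ℤ) (.up ℤ) (.up ℤ) (i, j) = n)
    (h₁ : ComplexShape.π (.up ℤ) (.up ℤ) (.up ℤ) (i + 1, j) = n')
    (h₂ : ComplexShape.π (.up ℤ) (.up ℤ) (.up ℤ) (i, j + 1) = n') :
    ιMapBifunctor K L F (.up ℤ) i j n h ≫ (mapBifunctor K L F (.up ℤ)).d n n' =
      ComplexShape.ε₁ (.up ℤ) (.up ℤ) (.up ℤ) (i, j) •
        ((F.map (K.d i (i + 1))).app (L.X j) ≫ ιMapBifunctor K L F (.up ℤ) (i + 1) j n' h₁) +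
      ComplexShape.ε₂ (.up ℤ) (.up ℤ) (.up ℤ) (i, j) •
        ((F.obj (K.X i)).map (L.d j (j + 1)) ≫ ιMapBifunctor K L F (.up ℤ) i (j + 1) n' h₂) := by
  rw [mapBifunctor.d_eq, Preadditive.comp_add, mapBifunctor.ι_D₁, mapBifunctor.ι_D₂,
    mapBifunctor.d₁_eq _ _ _ _ (i₁' := i + 1) rfl _ _ h₁,
    mapBifunctor.d₂_eq _ _ _ _ _ (i₂' := j + 1) rfl _ h₂]

variable (F' G₁ G₂) in
/-- The inclusion of a summand in the total complex of `F'(G₁ Kⁱ, G₂ Lʲ)`. -/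
def ιTotalMap (K : CochainComplex C₁ ℤ) (L : CochainComplex C₂ ℤ) (i j n : ℤ)
    (h : ComplexShape.π (.up ℤ) (.up ℤ) (.up ℤ) (i, j) = n) :
    (F'.obj (G₁.obj (K.X i))).obj (G₂.obj (L.X j)) ⟶ (totalMap F' G₁ G₂ K L).X n :=
  ιMapBifunctor ((G₁.mapHomologicalComplex (.up ℤ)).obj K)
    ((G₂.mapHomologicalComplex (.up ℤ)).obj L) F' (.up ℤ) i j n h

lemma totalMap_hom_ext {K : CochainComplex C₁ ℤ} {L : CochainComplex C₂ ℤ} {n : ℤ} {Y : D'}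
    {f g : (totalMap F' G₁ G₂ K L).X n ⟶ Y}
    (H : ∀ i j h, ιTotalMap F' G₁ G₂ K L i j n h ≫ f = ιTotalMap F' G₁ G₂ K L i j n h ≫ g) :
    f = g :=
  mapBifunctor.hom_ext H

/-- The terms of the image complexes are written here as `G₁.obj (K.X i)` and `G₂.obj (L.X j)`, so
that the naturality of a `BifunctorComp` applies by rewriting. -/
lemma ιTotalMap_d (K : CochainComplex C₁ ℤ) (L : CochainComplex C₂ ℤ) (i j n n' : ℤ)
    (h : ComplexShape.π (.up ℤ) (.up ℤ) (.up ℤ) (i, j) = n)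
    (h₁ : ComplexShape.π (.up ℤ) (.up ℤ) (.up ℤ) (i + 1, j) = n')
    (h₂ : ComplexShape.π (.up ℤ) (.up ℤ) (.up ℤ) (i, j + 1) = n') :
    ιTotalMap F' G₁ G₂ K L i j n h ≫ (totalMap F' G₁ G₂ K L).d n n' =
      ComplexShape.ε₁ (.up ℤ) (.up ℤ) (.up ℤ) (i, j) •
        ((F'.map (G₁.map (K.d i (i + 1)))).app (G₂.obj (L.X j)) ≫
          ιTotalMap F' G₁ G₂ K L (i + 1) j n' h₁) +
      ComplexShape.ε₂ (.up ℤ) (.up ℤ) (.up ℤ) (i, j) •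
        ((F'.obj (G₁.obj (K.X i))).map (G₂.map (L.d j (j + 1))) ≫
          ιTotalMap F' G₁ G₂ K L i (j + 1) n' h₂) :=
  ι_mapBifunctor_d ((G₁.mapHomologicalComplex (.up ℤ)).obj K)
    ((G₂.mapHomologicalComplex (.up ℤ)).obj L) i j n n' h h₁ h₂

/-- In each degree, the comparison of `G` of a total complex with the total complex of `G`. -/
def mapTotalHomX (K : CochainComplex C₁ ℤ) (L : CochainComplex C₂ ℤ) (n : ℤ) :
    (totalMap F' G₁ G₂ K L).X n ⟶ G.obj ((mapBifunctor K L F (.up ℤ)).X n) :=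
  mapBifunctorDesc fun i j h ↦ (e.iso (K.X i) (L.X j)).hom ≫
    G.map (ιMapBifunctor K L F (.up ℤ) i j n h)

omit [G.Additive] in
lemma ι_mapTotalHomX (K : CochainComplex C₁ ℤ) (L : CochainComplex C₂ ℤ) (i j n : ℤ)
    (h : ComplexShape.π (.up ℤ) (.up ℤ) (.up ℤ) (i, j) = n) :
    ιTotalMap F' G₁ G₂ K L i j n h ≫ mapTotalHomX e K L n =
      (e.iso (K.X i) (L.X j)).hom ≫ G.map (ιMapBifunctor K L F (.up ℤ) i j n h) :=
  ι_mapBifunctorDesc _ _ _ _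

omit [HasCoproducts.{0} D] [HasCoproducts.{0} D'] in
lemma map_units_zsmul {X Y : D} (f : X ⟶ Y) (a : ℤˣ) : G.map (a • f) = a • G.map f :=
  G.map_zsmul

/-- On each summand the two signs agree on both sides and pass through the additive functor `G`;
what remains is naturality of `e` in each variable, applied to the two differentials. -/
lemma mapTotalHomX_comm (K : CochainComplex C₁ ℤ) (L : CochainComplex C₂ ℤ) (n n' : ℤ)
    (hn : (ComplexShape.up ℤ).Rel n n') :
    mapTotalHomX e K L n ≫ G.map ((mapBifunctor K L F (.up ℤ)).d n n') =
      (totalMap F' G₁ G₂ K L).d n n' ≫ mapTotalHomX e K L n' := by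
  have hn : n + 1 = n' := hn
  refine totalMap_hom_ext fun i j h ↦ ?_
  have h' : i + j = n := h
  have h₁ : ComplexShape.π (.up ℤ) (.up ℤ) (.up ℤ) (i + 1, j) = n' := by
    change i + 1 + j = n'; lia
  have h₂ : ComplexShape.π (.up ℤ) (.up ℤ) (.up ℤ) (i, j + 1) = n' := by
    change i + (j + 1) = n'; lia
  rw [reassoc_of% ι_mapTotalHomX e, ← G.map_comp, ι_mapBifunctor_d K L i j n n' h h₁ h₂,
    ← Category.assoc, ιTotalMap_d K L i j n n' h h₁ h₂]
  simp only [Preadditive.comp_add, Preadditive.add_comp, G.map_add, map_units_zsmul,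
    Linear.units_smul_comp, Linear.comp_units_smul, Category.assoc, ι_mapTotalHomX, G.map_comp]
  rw [reassoc_of% e.naturality_left, reassoc_of% e.naturality_right]

/-- The comparison of `G` of a total complex with the total complex of `G`. -/
def mapTotalHom (K : CochainComplex C₁ ℤ) (L : CochainComplex C₂ ℤ) :
    totalMap F' G₁ G₂ K L ⟶ (G.mapHomologicalComplex (.up ℤ)).obj (mapBifunctor K L F (.up ℤ)) where
  f n := mapTotalHomX e K L n
  comm' n n' hn := mapTotalHomX_comm e K L n n' hn

variable [PreservesColimitsOfSize.{0, 0} G]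

/-- `G` applied to the coproduct in degree `n` of a total complex is a coproduct. -/
def isColimitMapTotal (G : D ⥤ D') [PreservesColimitsOfSize.{0, 0} G]
    (K : CochainComplex C₁ ℤ) (L : CochainComplex C₂ ℤ) (n : ℤ) :
    IsColimit (Cofan.mk (G.obj ((mapBifunctor K L F (.up ℤ)).X n))
      fun i : (ComplexShape.π (.up ℤ) (.up ℤ) (.up ℤ)) ⁻¹' {n} ↦
        G.map (ιMapBifunctor K L F (.up ℤ) i.1.1 i.1.2 n i.2)) :=
  isColimitCofanMkObjOfIsColimit G
    (fun i : (ComplexShape.π (.up ℤ) (.up ℤ) (.up ℤ)) ⁻¹' {n} ↦ (F.obj (K.X i.1.1)).obj (L.X i.1.2))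
    (fun i ↦ ιMapBifunctor K L F (.up ℤ) i.1.1 i.1.2 n i.2)
    ((((F.mapBifunctorHomologicalComplex _ _).obj K).obj L).toGradedObject.isColimitCofanMapObj
      (ComplexShape.π (.up ℤ) (.up ℤ) (.up ℤ)) n)

/-- The inverse of `mapTotalHomX`. -/
def mapTotalInvX (K : CochainComplex C₁ ℤ) (L : CochainComplex C₂ ℤ) (n : ℤ) :
    G.obj ((mapBifunctor K L F (.up ℤ)).X n) ⟶ (totalMap F' G₁ G₂ K L).X n :=
  Cofan.IsColimit.desc (isColimitMapTotal G K L n) fun i ↦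
    (e.iso (K.X i.1.1) (L.X i.1.2)).inv ≫ ιTotalMap F' G₁ G₂ K L i.1.1 i.1.2 n i.2

omit [G.Additive] in
lemma ι_mapTotalInvX (K : CochainComplex C₁ ℤ) (L : CochainComplex C₂ ℤ) (i j n : ℤ)
    (h : ComplexShape.π (.up ℤ) (.up ℤ) (.up ℤ) (i, j) = n) :
    G.map (ιMapBifunctor K L F (.up ℤ) i j n h) ≫ mapTotalInvX e K L n =
      (e.iso (K.X i) (L.X j)).inv ≫ ιTotalMap F' G₁ G₂ K L i j n h :=
  Cofan.IsColimit.fac (isColimitMapTotal G K L n) _ ⟨(i, j), h⟩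

/-- Source and target are coproducts over the same bidegrees, the target because `G` preserves
coproducts, and the map is the isomorphism `e.iso` on each summand. -/
instance isIso_mapTotalHomX (K : CochainComplex C₁ ℤ) (L : CochainComplex C₂ ℤ) (n : ℤ) :
    IsIso (mapTotalHomX e K L n) := by
  refine ⟨mapTotalInvX e K L n, ?_, ?_⟩
  · refine totalMap_hom_ext fun i j h ↦ ?_
    rw [reassoc_of% ι_mapTotalHomX e, ι_mapTotalInvX, Iso.hom_inv_id_assoc, Category.comp_id]
  · refine Cofan.IsColimit.hom_ext (isColimitMapTotal G K L n) _ _ fun ⟨⟨i, j⟩, h⟩ ↦ ?_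
    replace h : ComplexShape.π (.up ℤ) (.up ℤ) (.up ℤ) (i, j) = n := h
    change G.map (ιMapBifunctor K L F (.up ℤ) i j n h) ≫ _ =
      G.map (ιMapBifunctor K L F (.up ℤ) i j n h) ≫ 𝟙 _
    rw [reassoc_of% ι_mapTotalInvX e, ι_mapTotalHomX, Iso.inv_hom_id_assoc, Category.comp_id]

instance isIso_mapTotalHom (K : CochainComplex C₁ ℤ) (L : CochainComplex C₂ ℤ) :
    IsIso (mapTotalHom e K L) :=
  have (n : ℤ) : IsIso ((mapTotalHom e K L).f n) :=
    inferInstanceAs (IsIso (mapTotalHomX e K L n))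
  HomologicalComplex.Hom.isIso_of_components _

omit [PreservesColimitsOfSize.{0, 0} G]

lemma ι_mapBifunctorMap_left {K K' : CochainComplex C₁ ℤ} (f : K ⟶ K') (L : CochainComplex C₂ ℤ)
    (i j n : ℤ) (h : ComplexShape.π (.up ℤ) (.up ℤ) (.up ℤ) (i, j) = n) :
    ιMapBifunctor K L F (.up ℤ) i j n h ≫ (mapBifunctorMap f (𝟙 L) F (.up ℤ)).f n =
      (F.map (f.f i)).app (L.X j) ≫ ιMapBifunctor K' L F (.up ℤ) i j n h := by
  rw [ι_mapBifunctorMap, HomologicalComplex.id_f, CategoryTheory.Functor.map_id, Category.id_comp]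

lemma ι_mapBifunctorMap_right (K : CochainComplex C₁ ℤ) {L L' : CochainComplex C₂ ℤ} (g : L ⟶ L')
    (i j n : ℤ) (h : ComplexShape.π (.up ℤ) (.up ℤ) (.up ℤ) (i, j) = n) :
    ιMapBifunctor K L F (.up ℤ) i j n h ≫ (mapBifunctorMap (𝟙 K) g F (.up ℤ)).f n =
      (F.obj (K.X i)).map (g.f j) ≫ ιMapBifunctor K L' F (.up ℤ) i j n h := by
  rw [ι_mapBifunctorMap, HomologicalComplex.id_f, CategoryTheory.Functor.map_id, NatTrans.id_app,
    Category.id_comp]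

variable (F' G₁ G₂) in
/-- The map of total complexes induced by a map in the first variable. -/
def totalMapLeft {K K' : CochainComplex C₁ ℤ} (f : K ⟶ K') (L : CochainComplex C₂ ℤ) :
    totalMap F' G₁ G₂ K L ⟶ totalMap F' G₁ G₂ K' L :=
  mapBifunctorMap ((G₁.mapHomologicalComplex (.up ℤ)).map f) (𝟙 _) F' (.up ℤ)

variable (F' G₁ G₂) in
/-- The map of total complexes induced by a map in the second variable. -/
def totalMapRight (K : CochainComplex C₁ ℤ) {L L' : CochainComplex C₂ ℤ} (g : L ⟶ L') :
    totalMap F' G₁ G₂ K L ⟶ totalMap F' G₁ G₂ K L' :=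
  mapBifunctorMap (𝟙 _) ((G₂.mapHomologicalComplex (.up ℤ)).map g) F' (.up ℤ)

lemma ιTotalMap_left {K K' : CochainComplex C₁ ℤ} (f : K ⟶ K') (L : CochainComplex C₂ ℤ)
    (i j n : ℤ) (h : ComplexShape.π (.up ℤ) (.up ℤ) (.up ℤ) (i, j) = n) :
    ιTotalMap F' G₁ G₂ K L i j n h ≫ (totalMapLeft F' G₁ G₂ f L).f n =
      (F'.map (G₁.map (f.f i))).app (G₂.obj (L.X j)) ≫ ιTotalMap F' G₁ G₂ K' L i j n h :=
  ι_mapBifunctorMap_left _ _ _ _ _ _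

lemma ιTotalMap_right (K : CochainComplex C₁ ℤ) {L L' : CochainComplex C₂ ℤ} (g : L ⟶ L')
    (i j n : ℤ) (h : ComplexShape.π (.up ℤ) (.up ℤ) (.up ℤ) (i, j) = n) :
    ιTotalMap F' G₁ G₂ K L i j n h ≫ (totalMapRight F' G₁ G₂ K g).f n =
      (F'.obj (G₁.obj (K.X i))).map (G₂.map (g.f j)) ≫ ιTotalMap F' G₁ G₂ K L' i j n h :=
  ι_mapBifunctorMap_right _ _ _ _ _ _

lemma mapTotalHom_naturality_left {K K' : CochainComplex C₁ ℤ} (f : K ⟶ K')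
    (L : CochainComplex C₂ ℤ) :
    totalMapLeft F' G₁ G₂ f L ≫ mapTotalHom e K' L =
      mapTotalHom e K L ≫ (G.mapHomologicalComplex (.up ℤ)).map
        (mapBifunctorMap f (𝟙 L) F (.up ℤ)) := by
  refine HomologicalComplex.hom_ext _ _ fun n ↦ totalMap_hom_ext fun i j h ↦ ?_
  change ιTotalMap F' G₁ G₂ K L i j n h ≫ (totalMapLeft F' G₁ G₂ f L).f n ≫
    mapTotalHomX e K' L n = ιTotalMap F' G₁ G₂ K L i j n h ≫ mapTotalHomX e K L n ≫
      G.map ((mapBifunctorMap f (𝟙 L) F (.up ℤ)).f n)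
  rw [reassoc_of% ιTotalMap_left (F' := F') (G₁ := G₁) (G₂ := G₂), ι_mapTotalHomX,
    reassoc_of% ι_mapTotalHomX e,
    reassoc_of% e.naturality_left, ← G.map_comp, ← G.map_comp, ι_mapBifunctorMap_left]

lemma mapTotalHom_naturality_right (K : CochainComplex C₁ ℤ) {L L' : CochainComplex C₂ ℤ}
    (g : L ⟶ L') :
    totalMapRight F' G₁ G₂ K g ≫ mapTotalHom e K L' =
      mapTotalHom e K L ≫ (G.mapHomologicalComplex (.up ℤ)).map
        (mapBifunctorMap (𝟙 K) g F (.up ℤ)) := by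
  refine HomologicalComplex.hom_ext _ _ fun n ↦ totalMap_hom_ext fun i j h ↦ ?_
  change ιTotalMap F' G₁ G₂ K L i j n h ≫ (totalMapRight F' G₁ G₂ K g).f n ≫
    mapTotalHomX e K L' n = ιTotalMap F' G₁ G₂ K L i j n h ≫ mapTotalHomX e K L n ≫
      G.map ((mapBifunctorMap (𝟙 K) g F (.up ℤ)).f n)
  rw [reassoc_of% ιTotalMap_right (F' := F') (G₁ := G₁) (G₂ := G₂), ι_mapTotalHomX,
    reassoc_of% ι_mapTotalHomX e,
    reassoc_of% e.naturality_right, ← G.map_comp, ← G.map_comp, ι_mapBifunctorMap_right]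

end MapTotal

/-! ### The comparison on bounded above homotopy categories -/

section MinusComp

open Limits HomologicalComplex

variable {C₁ C₂ D C₁' C₂' D' : Type*} [Category* C₁] [Category* C₂] [Category* D]
  [Category* C₁'] [Category* C₂'] [Category* D'] [Abelian C₁] [Abelian C₂] [Abelian D]
  [Abelian C₁'] [Abelian C₂'] [Abelian D'] [HasCoproducts.{0} D] [HasCoproducts.{0} D']
  {F : C₁ ⥤ C₂ ⥤ D} [F.Additive] [∀ X, (F.obj X).Additive]
  {F' : C₁' ⥤ C₂' ⥤ D'} [F'.Additive] [∀ X, (F'.obj X).Additive]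
  {G₁ : C₁ ⥤ C₁'} {G₂ : C₂ ⥤ C₂'} {G : D ⥤ D'} [G₁.Additive] [G₂.Additive] [G.Additive]

variable (e : BifunctorComp F F' G₁ G₂ G)

variable [PreservesColimitsOfSize.{0, 0} G]

/-- The objectwise comparison in the homotopy category. -/
def minusCompIsoApp (X : HMinus C₁ × HMinus C₂) :
    ((mapMinus G₁).prod (mapMinus G₂) ⋙ map₂Minus F').obj X ≅
      (map₂Minus F ⋙ mapMinus G).obj X :=
  ObjectProperty.isoMk _ ((HomotopyCategory.quotient D' (.up ℤ)).mapIso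
    (@asIso _ _ _ _ (mapTotalHom e X.1.1.as X.2.1.as)
      (isIso_mapTotalHom e X.1.1.as X.2.1.as)))

/-- The functors `K⁻(C₁) × K⁻(C₂) ⥤ K⁻(D')` induced by `F'(G₁, G₂)` and by `G (F)` are
isomorphic. -/
def minusCompIso :
    (mapMinus G₁).prod (mapMinus G₂) ⋙ map₂Minus F' ≅ map₂Minus F ⋙ mapMinus G :=
  NatIso.ofComponents (minusCompIsoApp e) (by
    rintro ⟨⟨K, hK⟩, ⟨L, hL⟩⟩ ⟨⟨K', hK'⟩, ⟨L', hL'⟩⟩ ⟨⟨f⟩, ⟨g⟩⟩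
    obtain ⟨K, rfl⟩ := HomotopyCategory.quotient_obj_surjective K
    obtain ⟨L, rfl⟩ := HomotopyCategory.quotient_obj_surjective L
    obtain ⟨K', rfl⟩ := HomotopyCategory.quotient_obj_surjective K'
    obtain ⟨L', rfl⟩ := HomotopyCategory.quotient_obj_surjective L'
    obtain ⟨f, rfl⟩ := (HomotopyCategory.quotient C₁ (.up ℤ)).map_surjective f
    obtain ⟨g, rfl⟩ := (HomotopyCategory.quotient C₂ (.up ℤ)).map_surjective g
    refine ObjectProperty.hom_ext _ ?_
    -- The uncurried bifunctor acts on `(f, g)` as `(f, 𝟙)` followed by `(𝟙, g)`, so naturality in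
    -- each variable separately suffices.
    have h : (totalMapLeft F' G₁ G₂ f L ≫ totalMapRight F' G₁ G₂ K' g) ≫ mapTotalHom e K' L' =
        mapTotalHom e K L ≫ (G.mapHomologicalComplex (.up ℤ)).map
          (mapBifunctorMap f (𝟙 L) F (.up ℤ) ≫ mapBifunctorMap (𝟙 K') g F (.up ℤ)) := by
      rw [Category.assoc, mapTotalHom_naturality_right, ← Category.assoc,
        mapTotalHom_naturality_left, Category.assoc, ← Functor.map_comp]
    exact congrArg (HomotopyCategory.quotient D' (.up ℤ)).map h)

end MinusComp

/-! ### The counit of the projective resolution adjunction -/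

section Resolution

variable {C : Type*} [Category* C] [Abelian C] [HasDerivedCategory C] [EnoughProjectives C]

/-- In particular the unit is invertible. -/
lemma projResAdj_unit_app (X : DerivedCategory.Minus C) :
    (projResAdj C).unit.app X = (projResIso C).inv.app X :=
  (projResHomEquiv_apply (𝟙 _)).trans ((congrArg (_ ≫ ·) ((toMinus C).map_id _)).trans
    (Category.comp_id _))

/-- The triangle identity exhibits this map as a right factor of an identity whose left factor, the
unit, is invertible. In other words, the resolution map `projRes K → K` is a quasi-isomorphism. -/
lemma isIso_toMinus_map_counit (K : HMinus C) :
    IsIso ((toMinus C).map ((projResAdj C).counit.app K)) := by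
  have h := (projResAdj C).right_triangle_components K
  rw [projResAdj_unit_app] at h
  have : IsIso ((projResIso C).inv.app ((toMinus C).obj K) ≫
    (toMinus C).map ((projResAdj C).counit.app K)) := h ▸ IsIso.id ((toMinus C).obj K)
  exact IsIso.of_isIso_comp_left ((projResIso C).inv.app ((toMinus C).obj K)) _

/-- Both the resolution and `L` lie in `K⁻(Proj C)`, and `K⁻(Proj C) ⥤ D⁻(C)` is fully faithful. It
thus reflects isomorphisms, and the counit becomes invertible in `D⁻(C)`. -/
lemma isIso_projResAdj_counit_app (L : HMinus C) (hL : isProj C L.1) :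
    IsIso ((projResAdj C).counit.app L) := by
  have := isIso_toMinus_map_counit L
  let L' : HMinusProj C := ⟨L.1, hL⟩
  let P : HMinusProj C := (projInclusion C ⋙ toMinus C).inv.obj ((toMinus C).obj L)
  let c : P ⟶ L' := (projInclusion C).preimage ((projResAdj C).counit.app L)
  have hc : (projInclusion C).map c = (projResAdj C).counit.app L :=
    (projInclusion C).map_preimage _
  have : IsIso ((projInclusion C ⋙ toMinus C).map c) := by
    rw [Functor.comp_map, hc]; exact this
  have : IsIso c := isIso_of_reflects_iso c (projInclusion C ⋙ toMinus C)
  exact hc ▸ Functor.map_isIso (projInclusion C) c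

lemma isProj_projRes (X : DerivedCategory.Minus C) : isProj C ((projRes C).obj X).1 :=
  ((projInclusion C ⋙ toMinus C).inv.obj X).2

end Resolution

/-! ### Composing left derived functors -/

section Comp

open Limits

variable {C C' : Type*} [Category* C] [Category* C'] [Abelian C] [Abelian C']
  [HasDerivedCategory C] [HasDerivedCategory C'] [EnoughProjectives C] [EnoughProjectives C']

omit [HasDerivedCategory C] [HasDerivedCategory C'] [EnoughProjectives C]
  [EnoughProjectives C'] in
lemma isProj_mapMinus (G : C ⥤ C') [G.Additive] [G.PreservesProjectiveObjects] (K : HMinus C)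
    (hK : isProj C K.1) : isProj C' ((mapMinus G).obj K).1 :=
  ⟨((mapMinus G).obj K).2, fun i ↦ G.projective_obj_of_projective (hK.2 i)⟩

/-- If `G` preserves projectives, then `G` of a projective resolution is a projective resolution
of its image in the derived category. -/
def projResMapMinusIso (G : C ⥤ C') [G.Additive] [G.PreservesProjectiveObjects] :
    leftDerivedMinus G ⋙ projRes C' ≅ projRes C ⋙ mapMinus G :=
  -- The derived functor sends `X` to the class of `G (projRes X)`, already a complex of
  -- projectives, so the counit from its own resolution is a homotopy equivalence.
  NatIso.ofComponents (fun X ↦ @asIso _ _ _ _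
      ((projResAdj C').counit.app ((mapMinus G).obj ((projRes C).obj X)))
      (isIso_projResAdj_counit_app _ (isProj_mapMinus G _ (isProj_projRes X))))
    fun f ↦ (projResAdj C').counit.naturality ((mapMinus G).map ((projRes C).map f))

variable {C₁ C₂ D C₁' C₂' D' : Type*} [Category* C₁] [Category* C₂] [Category* D]
  [Category* C₁'] [Category* C₂'] [Category* D'] [Abelian C₁] [Abelian C₂] [Abelian D]
  [Abelian C₁'] [Abelian C₂'] [Abelian D'] [HasCoproducts.{0} D] [HasCoproducts.{0} D']
  [HasDerivedCategory C₁] [HasDerivedCategory C₂] [HasDerivedCategory D]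
  [HasDerivedCategory C₁'] [HasDerivedCategory C₂'] [HasDerivedCategory D']
  [EnoughProjectives C₁] [EnoughProjectives C₂] [EnoughProjectives D]
  [EnoughProjectives C₁'] [EnoughProjectives C₂']
  {F : C₁ ⥤ C₂ ⥤ D} [F.Additive] [∀ X, (F.obj X).Additive]
  {F' : C₁' ⥤ C₂' ⥤ D'} [F'.Additive] [∀ X, (F'.obj X).Additive]
  {G₁ : C₁ ⥤ C₁'} {G₂ : C₂ ⥤ C₂'} {G : D ⥤ D'} [G₁.Additive] [G₂.Additive] [G.Additive]
  [G₁.PreservesProjectiveObjects] [G₂.PreservesProjectiveObjects]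
  [PreservesColimitsOfSize.{0, 0} G]

variable (F' G₁ G₂) in
/-- The composite of `leftDerived₂Minus F'` with derived functors of functors that preserve
projectives is computed by projective resolutions. -/
def leftDerivedProdCompIso :
    (leftDerivedMinus G₁).prod (leftDerivedMinus G₂) ⋙ leftDerived₂Minus F' ≅
      (projRes C₁).prod (projRes C₂) ⋙ ((mapMinus G₁).prod (mapMinus G₂) ⋙ map₂Minus F') ⋙
        toMinus D' :=
  Functor.isoWhiskerRight (NatIso.prod (projResMapMinusIso G₁) (projResMapMinusIso G₂))
      (map₂Minus F' ⋙ toMinus D')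

/-- The composite of `leftDerived₂Minus F` with `leftDerivedMinus G` is computed by projective
resolutions if the total complexes of `F(P, Q)` for `P` and `Q` complexes of projectives are
acyclic for `G`. -/
def leftDerivedCompOfAcyclic
    (H : ∀ (K : HMinus C₁) (L : HMinus C₂), isProj C₁ K.1 → isProj C₂ L.1 →
      IsIso ((leftDerivedMinusCounit G).app ((map₂Minus F).obj (K, L)))) :
    leftDerived₂Minus F ⋙ leftDerivedMinus G ≅
      (projRes C₁).prod (projRes C₂) ⋙ (map₂Minus F ⋙ mapMinus G) ⋙ toMinus D' :=
  let P := (projRes C₁).prod (projRes C₂)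
  -- The counit of the derived functor of `G`, evaluated at the total complexes `F(P, Q)` of the
  -- chosen resolutions; it is invertible there by `H`.
  let τ := Functor.whiskerLeft P (Functor.whiskerLeft (map₂Minus F) (leftDerivedMinusCounit G))
  have _h (X : DerivedCategory.Minus C₁ × DerivedCategory.Minus C₂) : IsIso (τ.app X) :=
    H _ _ (isProj_projRes X.1) (isProj_projRes X.2)
  have : IsIso τ := NatIso.isIso_of_isIso_app τ
  Functor.associator P (map₂Minus F ⋙ toMinus D) (leftDerivedMinus G) ≪≫
    Functor.isoWhiskerLeft P (Functor.associator (map₂Minus F) (toMinus D) (leftDerivedMinus G)) ≪≫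
    asIso τ ≪≫
    Functor.isoWhiskerLeft P (Functor.associator (map₂Minus F) (mapMinus G) (toMinus D')).symm

/-- A natural isomorphism `F'(G₁, G₂) ≅ G (F)` induces an isomorphism between the left derived
functors, if `G₁` and `G₂` preserve projectives and if the total complexes of `F(P, Q)` for `P` and
`Q` complexes of projectives are acyclic for `G`. -/
def leftDerivedCompIso (e : BifunctorComp F F' G₁ G₂ G)
    (H : ∀ (K : HMinus C₁) (L : HMinus C₂), isProj C₁ K.1 → isProj C₂ L.1 →
      IsIso ((leftDerivedMinusCounit G).app ((map₂Minus F).obj (K, L)))) :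
    (leftDerivedMinus G₁).prod (leftDerivedMinus G₂) ⋙ leftDerived₂Minus F' ≅
      leftDerived₂Minus F ⋙ leftDerivedMinus G :=
  leftDerivedProdCompIso F' G₁ G₂ ≪≫
    Functor.isoWhiskerLeft ((projRes C₁).prod (projRes C₂))
      (Functor.isoWhiskerRight (minusCompIso e) (toMinus D')) ≪≫
    (leftDerivedCompOfAcyclic H).symm

end Comp

/-! ### A criterion for a complex to compute the derived functor -/

section Acyclic

variable {D D' : Type*} [Category* D] [Category* D'] [Abelian D] [Abelian D']
  [HasDerivedCategory D] [HasDerivedCategory D']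

/-- The inclusion of `D⁻` into the derived category reflects isomorphisms, and localization of
complexes inverts exactly the quasi-isomorphisms. -/
lemma isIso_toMinus_map_iff {K L : CochainComplex D ℤ} (hK : isMinus D _) (hL : isMinus D _)
    (f : K ⟶ L) : IsIso ((toMinus D).map (ObjectProperty.homMk
      ((HomotopyCategory.quotient D (.up ℤ)).map f) :
        (⟨(HomotopyCategory.quotient D (.up ℤ)).obj K, hK⟩ : HMinus D) ⟶
          ⟨(HomotopyCategory.quotient D (.up ℤ)).obj L, hL⟩)) ↔ QuasiIso f := by
  rw [← isIso_iff_of_reflects_iso _ DerivedCategory.Minus.ι,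
    ← DerivedCategory.isIso_Q_map_iff_quasiIso]
  exact (NatIso.isIso_map_iff (DerivedCategory.quotientCompQhIso D) f)

lemma isIso_toMinus_map_iff' {K L : HMinus D} (g : K ⟶ L) (f : K.1.as ⟶ L.1.as)
    (h : g.hom = (HomotopyCategory.quotient D (.up ℤ)).map f) :
    IsIso ((toMinus D).map g) ↔ QuasiIso f := by
  rw [← isIso_toMinus_map_iff K.2 L.2 f, ← h]
  exact Iff.rfl

variable [EnoughProjectives D]

/-- The derived functor of `G` agrees with `G` on the complexes `K` such that `G` preserves the
quasi-isomorphisms from complexes of projectives to `K`. -/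
lemma isIso_leftDerivedMinusCounit_app (G : D ⥤ D') [G.Additive] (K : HMinus D)
    (H : ∀ (P : CochainComplex D ℤ) (f : P ⟶ K.1.as), QuasiIso f → (∀ i, Projective (P.X i)) →
      (∃ n, P.IsStrictlyLE n) → QuasiIso ((G.mapHomologicalComplex (.up ℤ)).map f)) :
    IsIso ((leftDerivedMinusCounit G).app K) := by
  obtain ⟨hP, hP'⟩ := isProj_projRes ((toMinus D).obj K)
  -- A chain map representing the counit: a quasi-isomorphism to `K` from a bounded above complex of
  -- projectives, to which `H` applies.
  obtain ⟨f, hf⟩ := (HomotopyCategory.quotient D (.up ℤ)).map_surjective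
    (X := ((projRes D).obj ((toMinus D).obj K)).1.as) (Y := K.1.as)
    ((projResAdj D).counit.app K).hom
  have hq : QuasiIso f :=
    (isIso_toMinus_map_iff' _ f hf.symm).1 (isIso_toMinus_map_counit K)
  exact (isIso_toMinus_map_iff' ((mapMinus G).map ((projResAdj D).counit.app K))
    ((G.mapHomologicalComplex (.up ℤ)).map f)
    (congrArg (G.mapHomotopyCategory (.up ℤ)).map hf.symm)).2 (H _ f hq hP' hP)

end Acyclic

attribute [local instance] baseModule baseModule_tower

/-! ### Elements of `M ⊗_B N` and balanced maps -/

section Elements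

variable {K : Type u} [CommRing K] {A B C : Type u} [Ring A] [Ring B] [Ring C]
  [Algebra K A] [Algebra K B] [Algebra K C]

lemma tensor_induction {M : Bimod K A B} {N : Bimod K B C} {P : tensorObj M N → Prop}
    (zero : P 0) (add : ∀ x y, P x → P y → P (x + y)) (mk : ∀ m n, P (tensorMk m n)) (x) : P x := by
  obtain ⟨x, rfl⟩ := Submodule.Quotient.mk_surjective _ x
  change M ⊗[K] N at x
  induction x with
  | zero => exact zero
  | tmul m n => exact mk m n
  | add x y hx hy => exact add _ _ hx hy

lemma smul_tensorMk {M : Bimod K A B} {N : Bimod K B C} (a : A) (c : Cᵐᵒᵖ) (m : M) (n : N) :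
    (a ⊗ₜ[K] c) • tensorMk m n = tensorMk (leftAct M a m) (rightAct N c n) := rfl

lemma tensorMk_balanced {M : Bimod K A B} {N : Bimod K B C} (m : M) (b : B) (n : N) :
    tensorMk (rightAct M (MulOpposite.op b) m) n = tensorMk m (leftAct N b n) :=
  (Submodule.Quotient.eq (balancedRel M N)).2 (Submodule.subset_span ⟨(m, b, n), rfl⟩)

lemma tensorMk_zero_left {M : Bimod K A B} {N : Bimod K B C} (n : N) :
    tensorMk (0 : M) n = 0 :=
  congrArg (Submodule.Quotient.mk (p := balancedRel M N)) (TensorProduct.zero_tmul M n)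

lemma leftAct_mul_rightAct (M : Bimod K A B) (a : A) (b : Bᵐᵒᵖ) (m : M) :
    (leftAct M a * rightAct M b) m = (a ⊗ₜ[K] b) • m := by
  refine (mul_smul (a ⊗ₜ[K] (1 : Bᵐᵒᵖ)) ((1 : A) ⊗ₜ[K] b) m).symm.trans ?_
  rw [Algebra.TensorProduct.tmul_mul_tmul, mul_one, one_mul]

lemma base_smul_def (M : Bimod K A B) (k : K) (m : M) :
    k • m = algebraMap K (A ⊗[K] Bᵐᵒᵖ) k • m := rfl

lemma smul_eq_leftAct (M : Bimod K A B) (k : K) (m : M) :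
    k • m = leftAct M (algebraMap K A k) m := by
  rw [AlgHom.commutes, Module.algebraMap_end_apply]

lemma smul_eq_rightAct (M : Bimod K A B) (k : K) (m : M) :
    k • m = rightAct M (MulOpposite.op (algebraMap K B k)) m := by
  rw [← MulOpposite.algebraMap_apply, AlgHom.commutes, Module.algebraMap_end_apply]

lemma smul_tensorMk_left {M : Bimod K A B} {N : Bimod K B C} (k : K) (m : M) (n : N) :
    k • tensorMk m n = tensorMk (k • m) n := by
  rw [base_smul_def, Algebra.TensorProduct.algebraMap_apply, smul_tensorMk, map_one,
    smul_eq_leftAct M]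
  rfl

/-- A scalar of `K` acts on a bimodule through either side, so it acts on `M` through `B` and
crosses the tensor sign by balancedness. -/
lemma smul_tensorMk_right {M : Bimod K A B} {N : Bimod K B C} (k : K) (m : M) (n : N) :
    k • tensorMk m n = tensorMk m (k • n) := by
  rw [smul_tensorMk_left, smul_eq_rightAct M, tensorMk_balanced, ← smul_eq_leftAct]

/-- `tensorMk` as a biadditive map. -/
def tensorMkHom (M : Bimod K A B) (N : Bimod K B C) : M →+ N →+ tensorObj M N :=
  AddMonoidHom.mk' (fun m ↦ AddMonoidHom.mk' (tensorMk m) (tensorMk_add_right m))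
    fun m m' ↦ AddMonoidHom.ext (tensorMk_add_left m m')

lemma balanced_smul {M : Bimod K A B} {N : Bimod K B C} {Z : Type*} [AddCommMonoid Z]
    (f : M →+ N →+ Z)
    (hf : ∀ m b n, f (rightAct M (MulOpposite.op b) m) n = f m (leftAct N b n)) (k : K) (m : M)
    (n : N) : f (k • m) n = f m (k • n) := by
  rw [smul_eq_rightAct, hf, ← smul_eq_leftAct]

/-- The target is only an additive monoid, so the difference cannot be formed after applying `φ`. -/
lemma map_sub_eq_zero {X Z : Type*} [AddCommGroup X] [AddCommMonoid Z] (φ : X →+ Z) {x y : X}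
    (h : φ x = φ y) : φ (x - y) = 0 := by
  rw [sub_eq_add_neg, map_add, h, ← map_add, add_neg_cancel, map_zero]

/-- The additive map on `M ⊗_B N` induced by a balanced biadditive map. -/
def tensorLift {M : Bimod K A B} {N : Bimod K B C} {Z : Type*} [AddCommMonoid Z] (f : M →+ N →+ Z)
    (hf : ∀ m b n, f (rightAct M (MulOpposite.op b) m) n = f m (leftAct N b n)) :
    tensorObj M N →+ Z :=
  QuotientAddGroup.lift (M := Z) (balancedRel M N).toAddSubgroup
    (TensorProduct.liftAddHom f fun k m n ↦ balanced_smul f hf k m n) (by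
      let φ : Outer M N →+ Z := TensorProduct.liftAddHom f fun k m n ↦ balanced_smul f hf k m n
      -- The relations span a submodule over `A ⊗ Cᵒᵖ`, while `φ` is merely additive. Its kernel is
      -- replaced by the largest submodule inside it: the elements all of whose multiples are
      -- killed.
      let p : Submodule (A ⊗[K] Cᵐᵒᵖ) (Outer M N) :=
        { carrier := {x | ∀ r : A ⊗[K] Cᵐᵒᵖ, φ (r • x) = 0}
          zero_mem' r := (congrArg φ (smul_zero r)).trans (map_zero φ)
          add_mem' {x y} hx hy r := (congrArg φ (smul_add r x y)).trans
            ((map_add φ _ _).trans (by rw [hx, hy, add_zero]))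
          smul_mem' s x hx r := (congrArg φ (smul_smul r s x)).trans (hx (r * s)) }
      have h : balancedRel M N ≤ p := by
        refine Submodule.span_le.2 ?_
        rintro x ⟨⟨m, b, n⟩, hx⟩ r
        induction r with
        | zero => exact (congrArg φ (zero_smul (A ⊗[K] Cᵐᵒᵖ) x)).trans (map_zero φ)
        | add r s hr hs =>
          exact (congrArg φ (add_smul r s x)).trans
            ((map_add φ _ _).trans (by rw [hr, hs, add_zero]))
        | tmul a c =>
          subst hx
          refine (congrArg φ (smul_sub (a ⊗ₜ[K] c) _ _)).trans (map_sub_eq_zero φ ?_)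
          -- A multiple of a balancing relation by `a ⊗ c` is again one, because the left and right
          -- actions on `M` and on `N` commute.
          change f (leftAct M a (rightAct M _ m)) (rightAct N c n) =
            f (leftAct M a m) (rightAct N c (leftAct N b n))
          rw [← Module.End.mul_apply, (leftAct_comm M a _).eq, Module.End.mul_apply, hf,
            ← Module.End.mul_apply, (leftAct_comm N b c).eq, Module.End.mul_apply]
      exact fun x hx ↦ (congrArg φ (one_smul _ x)).symm.trans (h hx 1))

end Elements

/-! ### Flatness over `K` of projective bimodules and their tensor products -/

section Flat

variable {K : Type u} [CommRing K] {A B C : Type u} [Ring A] [Ring B] [Ring C]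
  [Algebra K A] [Algebra K B] [Algebra K C]

lemma flat_mulOpposite [Module.Flat K B] : Module.Flat K Bᵐᵒᵖ :=
  Module.Flat.of_linearEquiv (MulOpposite.opLinearEquiv K).symm

/-- A projective `R`-module is a retract of a free one, which is a direct sum of copies of the
`K`-flat module `R`. -/
lemma flat_of_projective {R : Type u} [Ring R] [Algebra K R] [Module.Flat K R] (M : ModuleCat.{u} R)
    [Projective M] : Module.Flat K M := by
  have : Module.Projective R M := (IsProjective.iff_projective M).2 inferInstance
  obtain ⟨s, hs⟩ := Module.projective_def'.1 this
  classical
  have : Module.Flat K (M →₀ R) := .of_linearEquiv (finsuppLEquivDirectSum K R M)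
  exact .of_retract (s.restrictScalars K) ((Finsupp.linearCombination R id).restrictScalars K)
    (LinearMap.ext fun m ↦ LinearMap.congr_fun hs m)

variable (A) in
/-- The bilinear map `(a ⊗ b, n) ↦ a ⊗ b n`. -/
def actTensor (N : Bimod K B C) : A ⊗[K] Bᵐᵒᵖ →ₗ[K] N →ₗ[K] A ⊗[K] N :=
  TensorProduct.lift (((LinearMap.llcomp K N N (A ⊗[K] N)).comp (TensorProduct.mk K A N)).compl₂
    ((leftAct N).toLinearMap.comp (MulOpposite.opLinearEquiv K).symm.toLinearMap))

lemma actTensor_tmul (N : Bimod K B C) (a : A) (b : Bᵐᵒᵖ) (n : N) :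
    actTensor A N (a ⊗ₜ b) n = a ⊗ₜ leftAct N b.unop n := rfl

/-- This is the `B`-balancedness of `(r, n) ↦ actTensor A N r n`: right multiplication by `b` on the
bimodule `A ⊗ Bᵒᵖ` is left multiplication by `1 ⊗ op b`. -/
lemma actTensor_smul (N : Bimod K B C) (r : A ⊗[K] Bᵐᵒᵖ) (b : B) (n : N) :
    actTensor A N ((1 ⊗ₜ MulOpposite.op b) * r) n = actTensor A N r (leftAct N b n) := by
  induction r with
  | zero => simp
  | add r s hr hs => simp only [mul_add, map_add, LinearMap.add_apply, hr, hs]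
  | tmul a c =>
    rw [Algebra.TensorProduct.tmul_mul_tmul, actTensor_tmul, actTensor_tmul, one_mul,
      MulOpposite.unop_mul, MulOpposite.unop_op, map_mul, Module.End.mul_apply]

/-- `M` is a retract of a free `A ⊗ Bᵒᵖ`-module, and `(A ⊗ Bᵒᵖ) ⊗_B N` is `A ⊗_K N`. So `M ⊗_B N` is
a `K`-linear retract of a direct sum of copies of the flat module `A ⊗_K N`. -/
lemma flat_tensorObj [Module.Flat K A] (M : Bimod K A B) (N : Bimod K B C) [Projective M]
    [Module.Flat K N] : Module.Flat K (tensorObj M N) := by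
  have : Module.Projective (A ⊗[K] Bᵐᵒᵖ) M := (IsProjective.iff_projective M).2 inferInstance
  obtain ⟨s, hs⟩ := Module.projective_def'.1 this
  classical
  have : Module.Flat K (M →₀ A ⊗[K] N) := .of_linearEquiv (finsuppLEquivDirectSum K _ M)
  -- Apply the section `s` of the free cover of `M`, then let each coordinate act on `n`.
  let f : M →+ N →+ (M →₀ A ⊗[K] N) :=
    { toFun m :=
        { toFun n := Finsupp.mapRange.linearMap ((actTensor A N).flip n) (s m)
          map_zero' := by ext i : 1; simp
          map_add' n n' := by ext i : 1; simp }
      map_zero' := by ext n i : 2; simp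
      map_add' m m' := by ext n i : 2; simp }
  have hf (m : M) (n : N) (i : M) : f m n i = actTensor A N (s m i) n := by
    simp [f]
  let φ : tensorObj M N →+ (M →₀ A ⊗[K] N) := tensorLift f fun m b n ↦ by
    ext i : 1
    rw [hf, hf, ← actTensor_smul]
    congr 2
    exact DFunLike.congr_fun (s.map_smul (1 ⊗ₜ MulOpposite.op b) m) i
  let φ' : tensorObj M N →ₗ[K] (M →₀ A ⊗[K] N) :=
    { φ with
      map_smul' := fun k x ↦ by
        change φ (k • x) = k • φ x
        induction x using tensor_induction with
        | zero => simp
        | add x y hx hy => rw [smul_add, map_add, map_add, smul_add, hx, hy]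
        | mk m n =>
          rw [smul_tensorMk_right]
          ext i : 1
          refine (hf _ _ _).trans ?_
          rw [map_smul, ← hf]
          rfl }
  -- The retraction is induced by the free cover: in the coordinate indexed by `i`, it sends `a ⊗ n`
  -- to `a i ⊗ n`.
  let ψ : (M →₀ A ⊗[K] N) →ₗ[K] tensorObj M N := Finsupp.lsum K fun i ↦
    TensorProduct.lift (LinearMap.mk₂ K (fun a n ↦ tensorMk (leftAct M a i) n)
      (fun a a' n ↦ by rw [map_add, LinearMap.add_apply, tensorMk_add_left])
      (fun k a n ↦ by rw [map_smul, LinearMap.smul_apply, smul_tensorMk_left])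
      (fun a n n' ↦ by rw [tensorMk_add_right])
      (fun k a n ↦ by rw [smul_tensorMk_right]))
  have hψ (i : M) (r : A ⊗[K] Bᵐᵒᵖ) (n : N) :
      ψ (Finsupp.single i (actTensor A N r n)) = tensorMk (r • i) n := by
    rw [Finsupp.lsum_single]
    induction r with
    | zero =>
      simp only [map_zero, LinearMap.zero_apply]
      exact ((congrArg (tensorMk · n) (zero_smul (A ⊗[K] Bᵐᵒᵖ) i)).trans
        (tensorMk_zero_left n)).symm
    | add r t hr ht =>
      rw [map_add, LinearMap.add_apply, map_add, hr, ht, add_smul, tensorMk_add_left]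
    | tmul a b =>
      rw [actTensor_tmul]
      refine (tensorMk_balanced _ _ _).symm.trans (congrArg (tensorMk · n) ?_)
      rw [← Module.End.mul_apply, ← (leftAct_comm M a _).eq, leftAct_mul_rightAct]
      rfl
  refine .of_retract φ' ψ (LinearMap.ext fun x ↦ ?_)
  change ψ (φ x) = x
  induction x using tensor_induction with
  | zero => rw [map_zero, map_zero]
  | add x y hx hy => rw [map_add, map_add, hx, hy]
  | mk m n =>
    have h₁ : φ (tensorMk m n) = (s m).sum fun i r ↦ Finsupp.single i (actTensor A N r n) := by
      ext i : 1
      refine (hf m n i).trans ?_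
      rw [Finsupp.sum_apply, Finsupp.sum, Finset.sum_eq_single i]
      · simp
      · intro j _ hj
        rw [Finsupp.single_apply, if_neg hj]
      · intro hi
        simp [Finsupp.notMem_support_iff.1 hi]
    have h₂ : m = (s m).sum fun i r ↦ r • i := (LinearMap.congr_fun hs m).symm
    rw [h₁, map_finsuppSum]
    simp only [hψ]
    conv_rhs => rw [h₂]
    exact (map_finsuppSum ((tensorMkHom M N).flip n) _ _).symm

end Flat

/-! ### Base change of bounded above complexes of flat modules -/

section FlatAcyclic

/-- Bounded above acyclic complexes of flat modules remain exact after tensoring. -/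
lemma lTensor_exact_of_flat {K : Type u} [CommRing K] {M : ℤ → Type u} [∀ i, AddCommGroup (M i)]
    [∀ i, Module K (M i)] [∀ i, Module.Flat K (M i)] (d : ∀ i, M i →ₗ[K] M (i + 1))
    (hd : ∀ i, Function.Exact (d i) (d (i + 1))) (N : ℤ) (hN : ∀ i, N < i → Subsingleton (M i))
    (i : ℤ) (W : Type u) [AddCommGroup W] [Module K W] :
    Function.Exact ((d i).lTensor W) ((d (i + 1)).lTensor W) := by
  have hdd (V : Type u) [AddCommGroup V] [Module K V] (i : ℤ) (x : V ⊗[K] M i) :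
      (d (i + 1)).lTensor V ((d i).lTensor V x) = 0 := by
    rw [← LinearMap.comp_apply, ← LinearMap.lTensor_comp, (hd i).linearMap_comp_eq_zero,
      LinearMap.lTensor_zero, LinearMap.zero_apply]
  -- Descending induction from the upper bound `N`. The coefficient module `W` must vary: the
  -- inductive step presents it as a quotient of a free module and uses exactness one degree higher
  -- for the kernel `L`.
  have main (k : ℕ) : ∀ (i : ℤ) (_ : N - i ≤ k) (W : Type u) [AddCommGroup W] [Module K W],
      Function.Exact ((d i).lTensor W) ((d (i + 1)).lTensor W) := by
    induction k with
    | zero =>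
      intro i hi W _ _ x
      have := hN (i + 1) (by simp at hi; lia)
      have : Subsingleton (W ⊗[K] M (i + 1)) := inferInstance
      simp [Subsingleton.elim x 0]
      exact ⟨0, map_zero _⟩
    | succ k ih =>
      intro i hi W _ _
      let π : (W →₀ K) →ₗ[K] W := Finsupp.linearCombination K id
      have hπ : Function.Surjective π := Finsupp.linearCombination_id_surjective K W
      obtain ⟨L, _, _, ι, hι, hι'⟩ : ∃ (L : Type u) (_ : AddCommGroup L) (_ : Module K L)
          (ι : L →ₗ[K] (W →₀ K)), Function.Exact ι π ∧ Function.Injective ι :=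
        ⟨LinearMap.ker π, inferInstance, inferInstance, (LinearMap.ker π).subtype,
          π.exact_subtype_ker_map, Submodule.injective_subtype _⟩
      refine fun x ↦ ⟨fun hx ↦ ?_, ?_⟩
      · obtain ⟨y, rfl⟩ := LinearMap.rTensor_surjective (M (i + 1)) hπ x
        have comm {U V : Type u} [AddCommGroup U] [Module K U] [AddCommGroup V] [Module K V]
            (f : U →ₗ[K] V) (j : ℤ) (u : U ⊗[K] M j) :
            (d j).lTensor V (f.rTensor (M j) u) = f.rTensor (M (j + 1)) ((d j).lTensor U u) := by
          rw [← LinearMap.comp_apply, ← LinearMap.comp_apply, LinearMap.lTensor_comp_rTensor,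
            LinearMap.rTensor_comp_lTensor]
        rw [comm] at hx
        obtain ⟨z, hz⟩ := (rTensor_exact (M (i + 1 + 1)) hι hπ _).1 hx
        -- Flatness of the complex keeps `ι` injective after tensoring, so `z` is a cycle because
        -- its image `d y` is.
        have hz' : (d (i + 1 + 1)).lTensor _ z = 0 := by
          refine Module.Flat.rTensor_preserves_injective_linearMap (M := M (i + 1 + 1 + 1)) ι hι' ?_
          rw [map_zero, ← comm, hz, hdd]
        obtain ⟨w, rfl⟩ := (ih (i + 1) (by push_cast at hi; lia) _ z).1 hz'
        have hy : (d (i + 1)).lTensor _ (y - ι.rTensor _ w) = 0 := by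
          rw [map_sub, comm, hz, sub_self]
        -- The corrected lift `y - ι w` is a cycle with free, hence flat, coefficients, so it is a
        -- boundary; `π` kills the correction.
        obtain ⟨v, hv⟩ := (Module.Flat.lTensor_exact (W →₀ K) (hd i) _).1 hy
        refine ⟨π.rTensor _ v, ?_⟩
        rw [comm, hv, map_sub, sub_eq_self]
        exact (rTensor_exact (M (i + 1)) hι hπ _).2 ⟨w, rfl⟩
      · rintro ⟨v, rfl⟩
        exact hdd W i v
  exact main (N - i).toNat i (Int.self_le_toNat _) W

lemma flat_prod {K M N : Type u} [CommRing K] [AddCommGroup M] [AddCommGroup N] [Module K M]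
    [Module K N] [Module.Flat K M] [Module.Flat K N] : Module.Flat K (M × N) := by
  rw [Module.Flat.iff_lTensor_preserves_injective_linearMap]
  intro V W _ _ _ _ f hf
  have h : (TensorProduct.prodLeft K K M N W).toLinearMap ∘ₗ f.lTensor (M × N) =
      (f.lTensor M).prodMap (f.lTensor N) ∘ₗ (TensorProduct.prodLeft K K M N V).toLinearMap := by
    ext <;> simp
  have h' := ((Module.Flat.lTensor_preserves_injective_linearMap (M := M) f hf).prodMap
    (Module.Flat.lTensor_preserves_injective_linearMap (M := N) f hf)).comp
      (TensorProduct.prodLeft K K M N V).injective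
  refine Function.Injective.of_comp (f := TensorProduct.prodLeft K K M N W) ?_
  change Function.Injective ((TensorProduct.prodLeft K K M N W).toLinearMap ∘ₗ f.lTensor (M × N))
  rw [h]
  exact h'

variable (K K' : Type u) [CommRing K] [CommRing K'] [Algebra K K'] {A B C : Type u}
  [Ring A] [Ring B] [Ring C] [Algebra K A] [Algebra K B] [Algebra K C]

lemma acyclic_iff_exact {R : Type u} [Ring R] (X : CochainComplex (ModuleCat.{u} R) ℤ) :
    X.Acyclic ↔ ∀ i : ℤ, Function.Exact (X.d i (i + 1)) (X.d (i + 1) (i + 1 + 1)) := by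
  have h (i : ℤ) : X.ExactAt (i + 1) ↔
      Function.Exact (X.d i (i + 1)) (X.d (i + 1) (i + 1 + 1)) := by
    rw [X.exactAt_iff' i (i + 1) (i + 1 + 1) (by simp) (by simp)]
    exact ShortComplex.ShortExact.moduleCat_exact_iff_function_exact _
  exact ⟨fun hX i ↦ (h i).1 (hX _), fun hX i ↦ by simpa using (h (i - 1)).2 (hX _)⟩

variable {K}

lemma acyclic_baseChange (X : CochainComplex (Bimod K A B) ℤ) (hX : X.Acyclic) (n : ℤ)
    [X.IsStrictlyLE n] (hX' : ∀ i, Module.Flat K (X.X i)) :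
    (((baseChangeFunctor K K' A B).mapHomologicalComplex (.up ℤ)).obj X).Acyclic := by
  rw [acyclic_iff_exact] at hX ⊢
  intro i
  exact lTensor_exact_of_flat (K := K) (M := fun i ↦ X.X i)
    (fun i ↦ linOver (K := K) (X.d i (i + 1))) hX n
    (fun i hi ↦ ModuleCat.subsingleton_of_isZero (X.isZero_of_isStrictlyLE n i hi)) i K'

open CochainComplex in
-- In the homotopy category the quasi-isomorphisms are the maps with acyclic cone, and the mapping
-- cone completes `f` to a distinguished triangle.
lemma quasiIso_iff_acyclic_mappingCone {D : Type*} [Category* D] [Abelian D]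
    {X Y : CochainComplex D ℤ} (f : X ⟶ Y) : QuasiIso f ↔ (mappingCone f).Acyclic := by
  rw [← HomotopyCategory.quotient_obj_mem_subcategoryAcyclic_iff_acyclic,
    ← HomologicalComplex.mem_quasiIso_iff, ← HomotopyCategory.quotient_map_mem_quasiIso_iff,
    HomotopyCategory.quasiIso_eq_trW_subcategoryAcyclic]
  exact ObjectProperty.trW_iff_of_distinguished _ _
    (HomotopyCategory.mappingCone_triangleh_distinguished f)

open CochainComplex in
lemma mappingCone_isStrictlyLE {D : Type*} [Category* D] [Abelian D]
    {X Y : CochainComplex D ℤ} (f : X ⟶ Y) (m n : ℤ) [X.IsStrictlyLE m] [Y.IsStrictlyLE n] :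
    (mappingCone f).IsStrictlyLE (max m n) := by
  rw [isStrictlyLE_iff]
  intro i hi
  rw [Limits.IsZero.iff_id_eq_zero, ← mappingCone.id_X f i (i + 1) rfl,
    (X.isZero_of_isStrictlyLE m (i + 1) (by lia)).eq_of_src ((mappingCone.inl f).v _ _ _) 0,
    (Y.isZero_of_isStrictlyLE n i (by lia)).eq_of_src ((mappingCone.inr f).f i) 0,
    Limits.comp_zero, Limits.comp_zero, add_zero]

open CochainComplex in
-- Base change commutes with mapping cones. The cone of `f` is acyclic, bounded above and flat in
-- each degree, so its base change is still acyclic.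
lemma quasiIso_baseChange {X Y : CochainComplex (Bimod K A B) ℤ} (f : X ⟶ Y) (hf : QuasiIso f)
    (m n : ℤ) [X.IsStrictlyLE m] [Y.IsStrictlyLE n] (hX : ∀ i, Module.Flat K (X.X i))
    (hY : ∀ i, Module.Flat K (Y.X i)) :
    QuasiIso (((baseChangeFunctor K K' A B).mapHomologicalComplex (.up ℤ)).map f) := by
  rw [quasiIso_iff_acyclic_mappingCone] at hf ⊢
  have := mappingCone_isStrictlyLE f m n
  have h (i : ℤ) : Module.Flat K ((mappingCone f).X i) := by
    have : Module.Flat K (X.X (i + 1) × Y.X i) := flat_prod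
    refine .of_retract
      (((linOver ((mappingCone.fst f).1.v i (i + 1) rfl)).prod
        (linOver ((mappingCone.snd f).v i i (add_zero i)))) : _ →ₗ[K] X.X (i + 1) × Y.X i)
      ((linOver ((mappingCone.inl f).v (i + 1) i (by lia))).coprod
        (linOver ((mappingCone.inr f).f i))) ?_
    exact congrArg linOver (mappingCone.id_X f i (i + 1) rfl)
  have h' := acyclic_baseChange K' (mappingCone f) hf (max m n) h
  exact fun i ↦ (h' i).of_iso (mappingCone.mapHomologicalComplexIso f (baseChangeFunctor K K' A B))

variable [Module.Flat K A] [Module.Flat K B] [Module.Flat K C]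

open HomologicalComplex in
-- Degree `n` is a coproduct of modules `P_i ⊗_B Q_j`, each flat by `flat_tensorObj`. Only a
-- retraction from their direct sum is needed, so one of the two composites suffices.
lemma flat_mapBifunctor_tensor (P : CochainComplex (Bimod K A B) ℤ)
    (Q : CochainComplex (Bimod K B C) ℤ) (hP : ∀ i, Projective (P.X i))
    (hQ : ∀ i, Projective (Q.X i)) (n : ℤ) :
    Module.Flat K ((mapBifunctor P Q (tensorFunctor K A B C) (.up ℤ)).X n) := by
  have := flat_mulOpposite (K := K) (B := B)
  have := flat_mulOpposite (K := K) (B := C)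
  have (j : ℤ) : Module.Flat K (Q.X j) := flat_of_projective (Q.X j)
  have (i j : ℤ) : Module.Flat K (tensorObj (P.X i) (Q.X j)) := flat_tensorObj _ _
  let S := {p : ℤ × ℤ // p.1 + p.2 = n}
  let T := DirectSum S fun p ↦ tensorObj (P.X p.1.1) (Q.X p.1.2)
  have : Module.Flat K T := Module.Flat.directSum ..
  let φ : (mapBifunctor P Q (tensorFunctor K A B C) (.up ℤ)).X n ⟶
      ModuleCat.of (A ⊗[K] Cᵐᵒᵖ) T :=
    mapBifunctorDesc fun i j h ↦ ModuleCat.ofHom (DirectSum.lof (A ⊗[K] Cᵐᵒᵖ) S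
      (fun p ↦ tensorObj (P.X p.1.1) (Q.X p.1.2)) ⟨(i, j), h⟩)
  let g (p : S) : tensorObj (P.X p.1.1) (Q.X p.1.2) →ₗ[A ⊗[K] Cᵐᵒᵖ]
      (mapBifunctor P Q (tensorFunctor K A B C) (.up ℤ)).X n :=
    (ιMapBifunctor P Q (tensorFunctor K A B C) (.up ℤ) p.1.1 p.1.2 n p.2).hom
  let ψ : ModuleCat.of (A ⊗[K] Cᵐᵒᵖ) T ⟶
      (mapBifunctor P Q (tensorFunctor K A B C) (.up ℤ)).X n :=
    ModuleCat.ofHom (DirectSum.toModule _ _ _ g)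
  have h : φ ≫ ψ = 𝟙 _ := by
    refine mapBifunctor.hom_ext fun i j h ↦ ?_
    refine (ι_mapBifunctorDesc_assoc _ _ _ h ψ).trans (Eq.trans ?_ (Category.comp_id _).symm)
    exact ModuleCat.hom_ext (LinearMap.ext fun x ↦
      DirectSum.toModule_lof (A ⊗[K] Cᵐᵒᵖ) (φ := g) ⟨(i, j), h⟩ x)
  exact .of_retract (M := T) (linOver φ) (linOver ψ) (congrArg linOver h)

/-- The total complex of `P ⊗_B Q` and any bounded above complex of projectives mapping to it both
have `K`-flat terms, so base change preserves quasi-isomorphisms between them. -/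
lemma isIso_leftDerived_baseChange_counit (P : HMinus (Bimod K A B)) (Q : HMinus (Bimod K B C))
    (hP : isProj _ P.1) (hQ : isProj _ Q.1) :
    IsIso ((leftDerivedMinusCounit (baseChangeFunctor K K' A C)).app
      ((map₂Minus (tensorFunctor K A B C)).obj (P, Q))) := by
  refine isIso_leftDerivedMinusCounit_app _ _ fun X f hf hX ⟨m, hm⟩ ↦ ?_
  have := flat_mulOpposite (K := K) (B := C)
  obtain ⟨n, hn⟩ := ((map₂Minus (tensorFunctor K A B C)).obj (P, Q)).2
  exact quasiIso_baseChange K' f hf m n (fun i ↦ flat_of_projective _)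
    (flat_mapBifunctor_tensor P.1.as Q.1.as hP.2 hQ.2)

end FlatAcyclic

/-! ### Base change as a left adjoint of restriction of scalars -/

section BaseChangeAdj

variable (K K' : Type u) [CommRing K] [CommRing K'] [Algebra K K'] (A B : Type u)
  [Ring A] [Ring B] [Algebra K A] [Algebra K B]

/-- The ring map `A ⊗_K Bᵒᵖ → A' ⊗_{K'} B'ᵒᵖ`. -/
def baseRingHom : A ⊗[K] Bᵐᵒᵖ →+* (K' ⊗[K] A) ⊗[K'] (K' ⊗[K] B)ᵐᵒᵖ :=
  (Algebra.TensorProduct.lift (R := K) (S := K)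
    ((Algebra.TensorProduct.includeLeft (R := K') (S := K) (A := K' ⊗[K] A)
      (B := (K' ⊗[K] B)ᵐᵒᵖ)).comp Algebra.TensorProduct.includeRight)
    (((Algebra.TensorProduct.includeRight (R := K') (A := K' ⊗[K] A)
      (B := (K' ⊗[K] B)ᵐᵒᵖ)).restrictScalars K).comp (AlgHom.op Algebra.TensorProduct.includeRight))
    fun _ _ ↦ (Commute.one_right _).tmul (Commute.one_left _)).toRingHom

variable {A B}

lemma baseRingHom_tmul (a : A) (b : B) :
    baseRingHom K K' A B (a ⊗ₜ MulOpposite.op b) =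
      ((1 : K') ⊗ₜ[K] a) ⊗ₜ[K'] MulOpposite.op ((1 : K') ⊗ₜ[K] b) := by
  change ((1 : K') ⊗ₜ[K] a) ⊗ₜ[K'] (1 : (K' ⊗[K] B)ᵐᵒᵖ) * (1 : K' ⊗[K] A) ⊗ₜ[K']
    MulOpposite.op ((1 : K') ⊗ₜ[K] b) = _
  rw [Algebra.TensorProduct.tmul_mul_tmul, mul_one, one_mul]

lemma baseRingHom_algebraMap (k : K) :
    baseRingHom K K' A B (algebraMap K _ k) = algebraMap K' _ (algebraMap K K' k) := by
  rw [Algebra.TensorProduct.algebraMap_apply, Algebra.TensorProduct.algebraMap_apply,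
    Algebra.TensorProduct.algebraMap_apply, ← MulOpposite.op_one, baseRingHom_tmul,
    Algebra.algebraMap_eq_smul_one, TensorProduct.tmul_smul, TensorProduct.smul_tmul',
    Algebra.smul_def, mul_one]
  rfl

variable {K}

lemma baseRing_induction {P : (K' ⊗[K] A) ⊗[K'] (K' ⊗[K] B)ᵐᵒᵖ → Prop} (zero : P 0)
    (add : ∀ x y, P x → P y → P (x + y))
    (tmul : ∀ x a y b, P ((x ⊗ₜ a) ⊗ₜ MulOpposite.op (y ⊗ₜ b))) (r) : P r := by
  induction r with
  | zero => exact zero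
  | add r s hr hs => exact add _ _ hr hs
  | tmul a b =>
    induction b using MulOpposite.rec' with | _ b
    induction b with
    | zero => rwa [MulOpposite.op_zero, TensorProduct.tmul_zero]
    | add b c hb hc => rw [MulOpposite.op_add, TensorProduct.tmul_add]; exact add _ _ hb hc
    | tmul y b =>
      induction a with
      | zero => rwa [TensorProduct.zero_tmul]
      | add a c ha hc => rw [TensorProduct.add_tmul]; exact add _ _ ha hc
      | tmul x a => exact tmul x a y b

variable {K'}

/-- The element `z ⊗ m` of the base change of `M`. -/
def baseMk {M : Bimod K A B} (z : K') (m : M) : (baseChangeFunctor K K' A B).obj M :=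
  show BaseExt K' M from z ⊗ₜ[K] m

lemma baseMk_add_right {M : Bimod K A B} (z : K') (m m' : M) :
    baseMk z (m + m') = baseMk z m + baseMk z m' := TensorProduct.tmul_add z m m'

lemma smul_baseMk {M : Bimod K A B} (x y z : K') (a : A) (b : B) (m : M) :
    ((x ⊗ₜ[K] a) ⊗ₜ[K'] MulOpposite.op (y ⊗ₜ[K] b)) • baseMk z m =
      baseMk (x * (y * z)) (leftAct M a (rightAct M (MulOpposite.op b) m)) := rfl

lemma base_induction {M : Bimod K A B} {P : (baseChangeFunctor K K' A B).obj M → Prop} (zero : P 0)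
    (add : ∀ x y, P x → P y → P (x + y)) (mk : ∀ z m, P (baseMk z m)) (x) : P x := by
  change K' ⊗[K] M at x
  induction x with
  | zero => exact zero
  | tmul m n => exact mk m n
  | add x y hx hy => exact add _ _ hx hy

/-- The elements `1 ⊗ m` generate the base change over `A' ⊗ B'ᵒᵖ`, since `z ⊗ m` is the multiple of
`1 ⊗ m` by `(z ⊗ 1) ⊗ 1`. -/
lemma base_hom_ext {M : Bimod K A B} {X : Bimod K' (K' ⊗[K] A) (K' ⊗[K] B)}
    {f g : (baseChangeFunctor K K' A B).obj M ⟶ X}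
    (h : ∀ m, f.hom (baseMk 1 m) = g.hom (baseMk 1 m)) : f = g := by
  refine ModuleCat.hom_ext (LinearMap.ext fun x ↦ ?_)
  induction x using base_induction with
  | zero => rw [map_zero, map_zero]
  | add x y hx hy => rw [map_add, map_add, hx, hy]
  | mk z m =>
    have : baseMk z m = ((z ⊗ₜ[K] (1 : A)) ⊗ₜ[K'] MulOpposite.op ((1 : K') ⊗ₜ[K] (1 : B))) •
        baseMk 1 m := by
      rw [smul_baseMk, mul_one, mul_one, map_one, MulOpposite.op_one, map_one]
      rfl
    rw [this, map_smul, map_smul, h]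

/-- This is linearity of the adjunction unit `m ↦ 1 ⊗ m`. -/
lemma baseRingHom_smul_baseMk {M : Bimod K A B} (r : A ⊗[K] Bᵐᵒᵖ) (m : M) :
    baseRingHom K K' A B r • baseMk (1 : K') m = baseMk 1 (r • m) := by
  induction r with
  | zero =>
    rw [map_zero]
    refine (zero_smul ((K' ⊗[K] A) ⊗[K'] (K' ⊗[K] B)ᵐᵒᵖ) (baseMk (1 : K') m)).trans ?_
    exact ((congrArg (baseMk 1) (zero_smul (A ⊗[K] Bᵐᵒᵖ) m)).trans
      (TensorProduct.tmul_zero _ _)).symm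
  | add r s hr hs => rw [map_add, add_smul, add_smul, baseMk_add_right, hr, hs]
  | tmul a b =>
    induction b using MulOpposite.rec' with | _ b
    rw [baseRingHom_tmul, smul_baseMk, mul_one, mul_one, ← Module.End.mul_apply,
      leftAct_mul_rightAct]

/-- The image of `A ⊗ Bᵒᵖ` spans `A' ⊗ B'ᵒᵖ` over `K'`; compatibility with these two actions is thus
enough for linearity in `baseLift`. -/
lemma baseRing_tmul_eq_smul (x y : K') (a : A) (b : B) :
    (x ⊗ₜ[K] a) ⊗ₜ[K'] MulOpposite.op (y ⊗ₜ[K] b) =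
      (x * y) • baseRingHom K K' A B (a ⊗ₜ MulOpposite.op b) := by
  have h (c : K') {D : Type u} [Ring D] [Algebra K D] (d : D) :
      c ⊗ₜ[K] d = c • ((1 : K') ⊗ₜ[K] d) := by
    rw [TensorProduct.smul_tmul', smul_eq_mul, mul_one]
  rw [baseRingHom_tmul, h x, h y, MulOpposite.op_smul, TensorProduct.tmul_smul,
    ← TensorProduct.smul_tmul', smul_smul, mul_comm]

lemma smul_base_smul (X : Bimod K A B) (r : A ⊗[K] Bᵐᵒᵖ) (k : K) (v : X) :
    r • k • v = k • r • v := by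
  rw [base_smul_def, base_smul_def, smul_smul, ← Algebra.commutes, mul_smul]

/-- The map `z ⊗ m ↦ z • g m`. -/
def baseLift {M : Bimod K A B} {X : Bimod K' (K' ⊗[K] A) (K' ⊗[K] B)}
    (g : M ⟶ (ModuleCat.restrictScalars (baseRingHom K K' A B)).obj X) :
    (baseChangeFunctor K K' A B).obj M ⟶ X :=
  let g' : M →+ X := g.hom.toAddMonoidHom
  have hg (r : A ⊗[K] Bᵐᵒᵖ) (m : M) : g' (r • m) = baseRingHom K K' A B r • g' m :=
    g.hom.map_smul r m
  let f : BaseExt K' M →+ X := TensorProduct.liftAddHom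
    (AddMonoidHom.mk' (fun z : K' ↦ AddMonoidHom.mk' (fun m : M ↦ z • g' m) fun m m' ↦ by
        rw [map_add, smul_add])
      fun z z' ↦ AddMonoidHom.ext fun m ↦ add_smul z z' (g' m)) fun k z m ↦ by
        change (k • z) • g' m = z • g' (k • m)
        rw [base_smul_def M k m, hg, baseRingHom_algebraMap, ← base_smul_def X,
          Algebra.smul_def, mul_comm, mul_smul]
  have hf (z : K') (m : M) : f (baseMk z m) = z • g' m := rfl
  ModuleCat.ofHom (X := BaseExt K' M)
    { f with
      map_smul' := fun r x ↦ by
        change f (r • x) = r • f x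
        induction r using baseRing_induction with
        | zero =>
          exact (congrArg f (zero_smul ((K' ⊗[K] A) ⊗[K'] (K' ⊗[K] B)ᵐᵒᵖ) x)).trans
            ((map_zero f).trans (zero_smul ((K' ⊗[K] A) ⊗[K'] (K' ⊗[K] B)ᵐᵒᵖ) (f x)).symm)
        | add r s hr hs =>
          exact (congrArg f (add_smul r s x)).trans ((map_add f _ _).trans
            ((congrArg₂ (· + ·) hr hs).trans (add_smul r s (f x)).symm))
        | tmul x' a y b =>
          induction x using base_induction with
          | zero =>
            exact (congrArg f (smul_zero _)).trans
              ((map_zero f).trans ((congrArg (_ • ·) (map_zero f)).trans (smul_zero _)).symm)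
          | add v w hv hw =>
            exact (congrArg f (smul_add _ v w)).trans ((map_add f _ _).trans
              ((congrArg₂ (· + ·) hv hw).trans
                ((congrArg (_ • ·) (map_add f v w)).trans (smul_add _ (f v) (f w))).symm))
          | mk z m =>
            change (x' * (y * z)) • g' (leftAct M a (rightAct M (MulOpposite.op b) m)) =
              ((x' ⊗ₜ a) ⊗ₜ MulOpposite.op (y ⊗ₜ b)) • (z • g' m)
            rw [← Module.End.mul_apply, leftAct_mul_rightAct, hg, baseRing_tmul_eq_smul,
              smul_assoc, smul_base_smul, ← mul_assoc, mul_smul] }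

/-- Base change of bimodules is left adjoint to restriction of scalars. -/
def baseChangeAdj : baseChangeFunctor K K' A B ⊣
    ModuleCat.restrictScalars.{u} (baseRingHom K K' A B) :=
  Adjunction.mkOfHomEquiv
    { homEquiv _ X :=
        { toFun f := ModuleCat.ofHom (Y := (ModuleCat.restrictScalars (baseRingHom K K' A B)).obj X)
            { toFun m := f.hom (baseMk 1 m)
              map_add' m m' := (congrArg f.hom (baseMk_add_right _ m m')).trans (map_add f.hom _ _)
              map_smul' r m := (congrArg f.hom (baseRingHom_smul_baseMk r m).symm).trans
                (map_smul f.hom _ _) }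
          invFun g := baseLift g
          left_inv f := base_hom_ext fun m ↦ one_smul K' (f.hom (baseMk 1 m))
          right_inv g := ModuleCat.hom_ext (LinearMap.ext fun m ↦
            one_smul K' (show X from g.hom m)) }
      homEquiv_naturality_left_symm _ _ := base_hom_ext fun _ ↦ rfl
      homEquiv_naturality_right _ _ := rfl }

/-- The right adjoint, restriction of scalars, preserves epimorphisms. -/
instance : (baseChangeFunctor K K' A B).PreservesProjectiveObjects :=
  Functor.preservesProjectiveObjects_of_adjunction_of_preservesEpimorphisms baseChangeAdj

instance : Limits.PreservesColimitsOfSize.{0, 0} (baseChangeFunctor K K' A B) :=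
  baseChangeAdj.leftAdjoint_preservesColimits

end BaseChangeAdj

/-! ### Base change commutes with the tensor product of bimodules -/

section BaseChangeTensor

variable {K K' : Type u} [CommRing K] [CommRing K'] [Algebra K K'] {A B C : Type u}
  [Ring A] [Ring B] [Ring C] [Algebra K A] [Algebra K B] [Algebra K C]

lemma smul_baseMk_one {M : Bimod K A B} (z : K') (m : M) : z • baseMk 1 m = baseMk z m := by
  rw [base_smul_def]
  refine (smul_baseMk z 1 1 (1 : A) (1 : B) m).trans ?_
  rw [MulOpposite.op_one, map_one, map_one, mul_one, mul_one]
  rfl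

lemma leftAct_baseMk {M : Bimod K A B} (x z : K') (a : A) (m : M) :
    leftAct (K := K') ((baseChangeFunctor K K' A B).obj M) (x ⊗ₜ a) (baseMk z m) =
      baseMk (x * z) (leftAct M a m) := by
  refine (smul_baseMk x 1 z a 1 m).trans ?_
  rw [MulOpposite.op_one, map_one, one_mul, Module.End.one_apply]

lemma rightAct_baseMk {M : Bimod K A B} (y z : K') (b : B) (m : M) :
    rightAct (K := K') ((baseChangeFunctor K K' A B).obj M) (MulOpposite.op (y ⊗ₜ b)) (baseMk z m) =
      baseMk (y * z) (rightAct M (MulOpposite.op b) m) := by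
  refine Eq.trans (b := ((1 : K') ⊗ₜ[K] (1 : A)) ⊗ₜ[K'] MulOpposite.op (y ⊗ₜ[K] b) • baseMk z m)
    rfl ?_
  rw [smul_baseMk, map_one, one_mul, Module.End.one_apply]

lemma base_addHom_ext {M : Bimod K A B} {Z : Type*} [AddCommMonoid Z]
    {f g : (baseChangeFunctor K K' A B).obj M →+ Z}
    (h : ∀ z m, f (baseMk z m) = g (baseMk z m)) : f = g := by
  refine AddMonoidHom.ext fun x ↦ ?_
  induction x using base_induction with
  | zero => exact (map_zero f).trans (map_zero g).symm
  | add x y hx hy =>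
    exact (map_add f x y).trans ((congrArg₂ (· + ·) hx hy).trans (map_add g x y).symm)
  | mk z m => exact h z m

lemma tensor_addHom_ext {M : Bimod K A B} {N : Bimod K B C} {Z : Type*} [AddCommMonoid Z]
    {f g : tensorObj M N →+ Z} (h : ∀ m n, f (tensorMk m n) = g (tensorMk m n)) : f = g := by
  refine AddMonoidHom.ext fun x ↦ ?_
  induction x using tensor_induction with
  | zero => exact (map_zero f).trans (map_zero g).symm
  | add x y hx hy =>
    exact (map_add f x y).trans ((congrArg₂ (· + ·) hx hy).trans (map_add g x y).symm)
  | mk m n => exact h m n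

lemma tensor_base_addHom_ext {M : Bimod K A B} {N : Bimod K B C} {Z : Type*} [AddCommMonoid Z]
    {f g : tensorObj ((baseChangeFunctor K K' A B).obj M)
      ((baseChangeFunctor K K' B C).obj N) →+ Z}
    (h : ∀ z m w n, f (tensorMk (baseMk z m) (baseMk w n)) =
      g (tensorMk (baseMk z m) (baseMk w n))) : f = g := by
  have h' : (tensorMkHom _ _).compr₂ f = (tensorMkHom _ _).compr₂ g :=
    base_addHom_ext fun z m ↦ base_addHom_ext fun w n ↦ h z m w n
  exact tensor_addHom_ext fun x y ↦ DFunLike.congr_fun (DFunLike.congr_fun h' x) y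

lemma map_smul_of_baseRing {X Y : Type*} [AddCommGroup X] [AddCommGroup Y]
    [Module ((K' ⊗[K] A) ⊗[K'] (K' ⊗[K] B)ᵐᵒᵖ) X] [Module ((K' ⊗[K] A) ⊗[K'] (K' ⊗[K] B)ᵐᵒᵖ) Y]
    (φ : X →+ Y) (h : ∀ (x : K') (a : A) (y : K') (b : B) (t : X),
      φ (((x ⊗ₜ[K] a) ⊗ₜ[K'] MulOpposite.op (y ⊗ₜ[K] b)) • t) =
        ((x ⊗ₜ[K] a) ⊗ₜ[K'] MulOpposite.op (y ⊗ₜ[K] b)) • φ t)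
    (r : (K' ⊗[K] A) ⊗[K'] (K' ⊗[K] B)ᵐᵒᵖ) (t : X) : φ (r • t) = r • φ t := by
  induction r using baseRing_induction with
  | zero =>
    exact (congrArg φ (zero_smul ((K' ⊗[K] A) ⊗[K'] (K' ⊗[K] B)ᵐᵒᵖ) t)).trans
      ((map_zero φ).trans (zero_smul ((K' ⊗[K] A) ⊗[K'] (K' ⊗[K] B)ᵐᵒᵖ) (φ t)).symm)
  | add r s hr hs => rw [add_smul, map_add, hr, hs, add_smul]
  | tmul x a y b => exact h x a y b t

/-- The universal balanced map as a `K`-linear map on `M ⊗_K N`. -/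
def tensorProj (M : Bimod K A B) (N : Bimod K B C) : M ⊗[K] N →ₗ[K] tensorObj M N :=
  TensorProduct.lift (LinearMap.mk₂ K tensorMk tensorMk_add_left
    (fun k m n ↦ (smul_tensorMk_left k m n).symm) tensorMk_add_right
    fun k m n ↦ (smul_tensorMk_right k m n).symm)

variable (K') in
/-- The biadditive map `(z ⊗ m, w ⊗ n) ↦ z w ⊗ (m ⊗ n)`. -/
def baseTensorHom (M : Bimod K A B) (N : Bimod K B C) :
    (baseChangeFunctor K K' A B).obj M →+ (baseChangeFunctor K K' B C).obj N →+
      (baseChangeFunctor K K' A C).obj (tensorObj M N) :=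
  let Γ : (K' ⊗[K] M) ⊗[K'] (K' ⊗[K] N) →ₗ[K'] K' ⊗[K] tensorObj M N :=
    (tensorProj M N).baseChange K' ∘ₗ
      (AlgebraTensorModule.distribBaseChange K K' M N).symm.toLinearMap
  AddMonoidHom.mk' (fun x : K' ⊗[K] M ↦ AddMonoidHom.mk' (fun y : K' ⊗[K] N ↦ Γ (x ⊗ₜ y))
      fun y y' ↦ (congrArg Γ (TensorProduct.tmul_add (R := K') (M := K' ⊗[K] M)
        (N := K' ⊗[K] N) x y y')).trans (map_add Γ _ _))
    fun x x' ↦ AddMonoidHom.ext fun y : K' ⊗[K] N ↦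
      (congrArg Γ (TensorProduct.add_tmul (R := K') (M := K' ⊗[K] M)
        (N := K' ⊗[K] N) x x' y)).trans (map_add Γ _ _)

lemma baseTensorHom_mk {M : Bimod K A B} {N : Bimod K B C} (z w : K') (m : M) (n : N) :
    baseTensorHom K' M N (baseMk z m) (baseMk w n) = baseMk (z * w) (tensorMk m n) := by
  have h : (AlgebraTensorModule.distribBaseChange K K' M N).symm ((z ⊗ₜ m) ⊗ₜ (w ⊗ₜ n)) =
      (z * w) ⊗ₜ (m ⊗ₜ n) := by
    rw [LinearEquiv.symm_apply_eq]
    have : (w ⊗ₜ[K] n : K' ⊗[K] N) = w • (1 ⊗ₜ n) := by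
      rw [TensorProduct.smul_tmul', smul_eq_mul, mul_one]
    rw [this, TensorProduct.tmul_smul, TensorProduct.smul_tmul', TensorProduct.smul_tmul',
      smul_eq_mul, mul_comm]
    rfl
  exact congrArg ((tensorProj M N).baseChange K') h

/-- On pure tensors this combines balancedness over `B` with commutativity of `K'`. -/
lemma baseTensorHom_balanced {M : Bimod K A B} {N : Bimod K B C}
    (x : (baseChangeFunctor K K' A B).obj M) (b : K' ⊗[K] B)
    (y : (baseChangeFunctor K K' B C).obj N) :
    baseTensorHom K' M N (rightAct _ (MulOpposite.op b) x) y =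
      baseTensorHom K' M N x (leftAct _ b y) := by
  induction b with
  | zero => simp only [MulOpposite.op_zero, map_zero, LinearMap.zero_apply, AddMonoidHom.zero_apply]
  | add b c hb hc =>
    simp only [MulOpposite.op_add, map_add, LinearMap.add_apply, AddMonoidHom.add_apply, hb, hc]
  | tmul z b =>
    induction x using base_induction with
    | zero => simp only [map_zero, AddMonoidHom.zero_apply]
    | add x x' hx hx' => simp only [map_add, AddMonoidHom.add_apply, hx, hx']
    | mk z' m =>
      induction y using base_induction with
      | zero => simp only [map_zero]
      | add y y' hy hy' => simp only [map_add, hy, hy']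
      | mk w n =>
        rw [rightAct_baseMk, leftAct_baseMk, baseTensorHom_mk, baseTensorHom_mk, tensorMk_balanced,
          mul_comm z z', mul_assoc]

variable (K') in
/-- The map of bimodules `M' ⊗_{B'} N' ⟶ (M ⊗_B N)'`. -/
def baseTensor (M : Bimod K A B) (N : Bimod K B C) :
    tensorObj ((baseChangeFunctor K K' A B).obj M) ((baseChangeFunctor K K' B C).obj N) ⟶
      (baseChangeFunctor K K' A C).obj (tensorObj M N) :=
  let φ := tensorLift (baseTensorHom K' M N) baseTensorHom_balanced
  have h (x : K') (a : A) (y : K') (c : C) (t) :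
      φ (((x ⊗ₜ[K] a) ⊗ₜ[K'] MulOpposite.op (y ⊗ₜ[K] c)) • t) =
        ((x ⊗ₜ[K] a) ⊗ₜ[K'] MulOpposite.op (y ⊗ₜ[K] c)) • φ t := by
    let r := (x ⊗ₜ[K] a) ⊗ₜ[K'] MulOpposite.op (y ⊗ₜ[K] c)
    refine DFunLike.congr_fun (f := φ.comp (DistribSMul.toAddMonoidHom _ r))
      (g := (DistribSMul.toAddMonoidHom _ r).comp φ)
      (tensor_base_addHom_ext fun z m w n ↦ ?_) t
    refine (congrArg φ (smul_tensorMk (K := K') (x ⊗ₜ[K] a) (MulOpposite.op (y ⊗ₜ[K] c))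
      (baseMk z m) (baseMk w n))).trans ?_
    change baseTensorHom K' M N
        (leftAct (K := K') ((baseChangeFunctor K K' A B).obj M) (x ⊗ₜ[K] a) (baseMk z m))
        (rightAct (K := K') ((baseChangeFunctor K K' B C).obj N) (MulOpposite.op (y ⊗ₜ[K] c))
          (baseMk w n)) = ((x ⊗ₜ[K] a) ⊗ₜ[K'] MulOpposite.op (y ⊗ₜ[K] c)) •
      baseTensorHom K' M N (baseMk z m) (baseMk w n)
    rw [leftAct_baseMk, rightAct_baseMk, baseTensorHom_mk,
      baseTensorHom_mk, smul_baseMk, ← Module.End.mul_apply, leftAct_mul_rightAct, smul_tensorMk,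
      mul_mul_mul_comm, mul_assoc]
  ModuleCat.ofHom (Y := BaseExt K' (tensorObj M N))
    { φ with map_smul' := map_smul_of_baseRing φ h }

lemma baseTensor_mk {M : Bimod K A B} {N : Bimod K B C} (z w : K') (m : M) (n : N) :
    (baseTensor K' M N).hom (tensorMk (baseMk z m) (baseMk w n)) =
      baseMk (z * w) (tensorMk m n) :=
  baseTensorHom_mk z w m n

variable (K') in
/-- The map of bimodules `(M ⊗_B N)' ⟶ M' ⊗_{B'} N'`. -/
def baseTensorInv (M : Bimod K A B) (N : Bimod K B C) :
    (baseChangeFunctor K K' A C).obj (tensorObj M N) ⟶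
      tensorObj ((baseChangeFunctor K K' A B).obj M) ((baseChangeFunctor K K' B C).obj N) :=
  let T := tensorObj ((baseChangeFunctor K K' A B).obj M) ((baseChangeFunctor K K' B C).obj N)
  let f : M →+ N →+ T :=
    AddMonoidHom.mk' (fun m ↦ AddMonoidHom.mk' (fun n ↦ tensorMk (baseMk 1 m) (baseMk 1 n))
        fun n n' ↦ by rw [baseMk_add_right, tensorMk_add_right])
      fun m m' ↦ AddMonoidHom.ext fun n ↦
        (congrArg (tensorMk · (baseMk 1 n)) (baseMk_add_right 1 m m')).trans
          (tensorMk_add_left _ _ _)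
  let φ : tensorObj M N →+ T := tensorLift f fun m b n ↦ by
    change tensorMk (baseMk 1 (rightAct M (MulOpposite.op b) m)) (baseMk 1 n) =
      tensorMk (baseMk 1 m) (baseMk 1 (leftAct N b n))
    have h₁ := rightAct_baseMk (1 : K') 1 b m
    have h₂ := leftAct_baseMk (1 : K') 1 b n
    rw [mul_one] at h₁ h₂
    rw [← h₁, ← h₂, tensorMk_balanced]
  have h (a : A) (c : C) (t : tensorObj M N) : φ ((a ⊗ₜ[K] MulOpposite.op c) • t) =
      baseRingHom K K' A C (a ⊗ₜ[K] MulOpposite.op c) • φ t := by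
    refine DFunLike.congr_fun
      (f := φ.comp (DistribSMul.toAddMonoidHom _ (a ⊗ₜ[K] MulOpposite.op c)))
      (g := (DistribSMul.toAddMonoidHom _ (baseRingHom K K' A C (a ⊗ₜ[K] MulOpposite.op c))).comp φ)
      (tensor_addHom_ext fun m n ↦ ?_) t
    rw [baseRingHom_tmul]
    refine (congrArg φ (smul_tensorMk a (MulOpposite.op c) m n)).trans ?_
    change _ = (((1 : K') ⊗ₜ[K] a) ⊗ₜ[K'] MulOpposite.op ((1 : K') ⊗ₜ[K] c)) •
      tensorMk (baseMk (1 : K') m) (baseMk (1 : K') n)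
    rw [smul_tensorMk, leftAct_baseMk, rightAct_baseMk, mul_one]
    rfl
  have h' (r : A ⊗[K] Cᵐᵒᵖ) (t : tensorObj M N) : φ (r • t) = baseRingHom K K' A C r • φ t := by
    induction r with
    | zero =>
      exact (congrArg φ (zero_smul (A ⊗[K] Cᵐᵒᵖ) t)).trans ((map_zero φ).trans
        ((congrArg (· • φ t) (map_zero (baseRingHom K K' A C))).trans
          (zero_smul ((K' ⊗[K] A) ⊗[K'] (K' ⊗[K] C)ᵐᵒᵖ) (φ t))).symm)
    | add r s hr hs =>
      exact (congrArg φ (add_smul r s t)).trans ((map_add φ _ _).trans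
        ((congrArg₂ (· + ·) hr hs).trans
          ((congrArg (· • φ t) (map_add (baseRingHom K K' A C) r s)).trans
            (add_smul _ _ (φ t))).symm))
    | tmul a c => exact h a c.unop t
  baseLift (ModuleCat.ofHom (Y := (ModuleCat.restrictScalars (baseRingHom K K' A C)).obj T)
    { φ with map_smul' := h' })

lemma baseTensorInv_mk {M : Bimod K A B} {N : Bimod K B C} (z : K') (m : M) (n : N) :
    (baseTensorInv K' M N).hom (baseMk z (tensorMk m n)) =
      z • tensorMk (baseMk 1 m) (baseMk 1 n) := rfl

/-- Two maps out of `M' ⊗_{B'} N'` are equal if they agree on all `(z ⊗ m) ⊗ (w ⊗ n)`. -/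
lemma tensor_base_hom_ext {M : Bimod K A B} {N : Bimod K B C}
    {Z : Bimod K' (K' ⊗[K] A) (K' ⊗[K] C)}
    {φ ψ : tensorObj ((baseChangeFunctor K K' A B).obj M)
      ((baseChangeFunctor K K' B C).obj N) ⟶ Z}
    (h : ∀ z m w n, φ.hom (tensorMk (baseMk z m) (baseMk w n)) =
      ψ.hom (tensorMk (baseMk z m) (baseMk w n))) : φ = ψ := by
  exact ModuleCat.hom_ext (LinearMap.toAddMonoidHom_injective (tensor_base_addHom_ext h))

variable (K') in
/-- The isomorphism of bimodules `M' ⊗_{B'} N' ≅ (M ⊗_B N)'`. -/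
def baseTensorIso (M : Bimod K A B) (N : Bimod K B C) :
    tensorObj ((baseChangeFunctor K K' A B).obj M) ((baseChangeFunctor K K' B C).obj N) ≅
      (baseChangeFunctor K K' A C).obj (tensorObj M N) where
  hom := baseTensor K' M N
  inv := baseTensorInv K' M N
  hom_inv_id := tensor_base_hom_ext fun z m w n ↦ by
    refine (congrArg (baseTensorInv K' M N).hom (baseTensor_mk z w m n)).trans ?_
    -- The scalar `z w` is distributed over `(1 ⊗ m) ⊗ (1 ⊗ n)`: `w` goes to the right factor and
    -- `z` to the left.
    rw [baseTensorInv_mk, mul_smul, smul_tensorMk_right, smul_tensorMk_left, smul_baseMk_one,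
      smul_baseMk_one]
    rfl
  inv_hom_id := base_hom_ext fun t ↦ by
    induction t using tensor_induction with
    | zero =>
      have h : baseMk (1 : K') (0 : tensorObj M N) = 0 := TensorProduct.tmul_zero _ _
      rw [h, map_zero, map_zero]
    | add t t' ht ht' => rw [baseMk_add_right, map_add, map_add, ht, ht']
    | mk m n =>
      refine (congrArg (baseTensor K' M N).hom
        ((baseTensorInv_mk 1 m n).trans (one_smul K' _))).trans ?_
      rw [baseTensor_mk, mul_one]
      rfl

variable (K K' A B C) in
/-- Base change of bimodules commutes with tensor products, naturally. -/
def baseChangeTensorComp : BifunctorComp (tensorFunctor K A B C)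
    (tensorFunctor K' (K' ⊗[K] A) (K' ⊗[K] B) (K' ⊗[K] C)) (baseChangeFunctor K K' A B)
    (baseChangeFunctor K K' B C) (baseChangeFunctor K K' A C) where
  iso := baseTensorIso K'
  naturality_left f N := tensor_base_hom_ext fun z m w n ↦
    (baseTensor_mk z w (f.hom m) n).trans
      (congrArg ((baseChangeFunctor K K' A C).map (tensorMap f (𝟙 N))).hom
        (baseTensor_mk z w m n)).symm
  naturality_right M _ _ g := tensor_base_hom_ext fun z m w n ↦
    (baseTensor_mk z w m (g.hom n)).trans
      (congrArg ((baseChangeFunctor K K' A C).map (tensorMap (𝟙 M) g)).hom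
        (baseTensor_mk z w m n)).symm

end BaseChangeTensor

end DerivedBimod

end

theorem mainTheorem6 (K K' : Type u) [CommRing K] [CommRing K'] [Algebra K K']
    (A B C : Type u) [Ring A] [Ring B] [Ring C] [Algebra K A] [Algebra K B] [Algebra K C]
    [Module.Flat K A] [Module.Flat K B] [Module.Flat K C] :
    Nonempty
      ((DerivedBimod.derivedBaseChange K K' A B).prod (DerivedBimod.derivedBaseChange K K' B C) ⋙
          DerivedBimod.derivedTensor K' (K' ⊗[K] A) (K' ⊗[K] B) (K' ⊗[K] C) ≅
        DerivedBimod.derivedTensor K A B C ⋙ DerivedBimod.derivedBaseChange K K' A C) :=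
  ⟨DerivedBimod.leftDerivedCompIso (DerivedBimod.baseChangeTensorComp K K' A B C)
    (DerivedBimod.isIso_leftDerived_baseChange_counit K')⟩
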